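/- Fix $\alpha>0$. For $x=(x_1,x_2)\in\mathbb R^2$ put $x^\perp=(-x_2,x_1)$ and $$K^\alpha(x)=\nabla^\perp\Psi^\alpha(|x|)=\frac{x^\perp}{|x|}D\Psi^\alpha(|x|),\qquad D\Psi^\alpha(r)=\frac1{2\pi}\Big[-\frac1\alpha K_1\Big(\frac r\alpha\Big)+\frac1r\Big],\qquad K^\alpha(0)=0,$$ where $\Psi^\alpha(r)=\frac1{2\pi}[K_0(r/\alpha)+\log r]$ and $K_0,K_1$ are modified Bessel functions of the second kind. Let $\mathcal M(\mathbb R^2)$ be the space of finite signed Radon measures with its weak-$*$ topology (as the dual of $C_0(\mathbb R^2)$). Let $q\in C(\mathbb R;\mathcal M(\mathbb R^2))$ be a global weak solution of the 2D Euler-$\alpha$ equations $\partial_t q+(u\cdot\nabla)q=0$, $u=K^\alpha*q$, $q(\cdot,0)=q^{in}\in\mathcal M(\mathbb R^2)$; that is, the transport equation holds in the sense of distributions on $\mathbb R\times\mathbb R^2$, $u\in C(\mathbb R;C(\mathbb R^2))$, and $u$ has a Lagrangian flow map $\eta$, jointly continuous, consisting of Lebesgue-measure preserving homeomorphisms $\eta(\cdot,t)$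 of $\mathbb R^2$, with $\partial_t\eta(y,t)=u(\eta(y,t),t)$ and $\eta(y,0)=y$. Assume that for every $t$ the vorticity is carried by a curve $\Sigma(t)=\{x(\sigma,t):\sigma\in I(t)\}$ with density $\gamma(\cdot,t)$. Here $I(t)$ is an interval, bounded or not, with end points $\sigma_0(t)<\sigma_1(t)$, $x(\cdot,t)$ is continuous on $I(t)$ and differentiable a.e., $\gamma(\cdot,t)\in L^1(|x_\sigma|\,d\sigma)$, and $$\int_{\mathbb R^2}\varphi\,dq(\cdot,t)=\int_{\sigma_0(t)}^{\sigma_1(t)}\varphi(x(\sigma,t))\,\gamma(\sigma,t)\,|x_\sigma(\sigma,t)|\,d\sigma\qquad\text{for all }\varphi\in C_c^\infty(\mathbb R^2).$$ Then, with absolutely convergent integrals: (1) For every $t$ and $\sigma\in I(t)$, the fluid particle that is at $x(\sigma,t)$ at time $t$ has at that time the velocity $$U(\sigma,t)=\int_{\sigma_0(t)}^{\sigma_1(t)}K^\alpha\big(x(\sigma,t)-x(\sigma',t)\big)\,\gamma(\sigma',t)\,|x_\sigma(\sigma',t)|\,d\sigma'.$$ Hence the sheet evolves by $\partial_t x=U$,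 the time derivative being taken along particles of the sheet. Precisely, suppose that strictly increasing bijections $\ell_t:I(0)\to I(t)$ satisfy $x(\ell_t(a),t)=\eta(x(a,0),t)$ for all $a\in I(0)$ and all $t$. Then $\frac{d}{dt}\,x(\ell_t(a),t)=U(\ell_t(a),t)$. In particular, if $\sigma$ is a Lagrangian parameter ($I(t)=I(0)$ and $\ell_t(a)=a$), then $\partial_t x(\sigma,t)=U(\sigma,t)$. (2) Let $\ell_t$ be as in (1). Assume in addition that the curve is simple ($x(\cdot,t)$ is injective on the interior of $I(t)$ for every $t$), let $x(\sigma^*(t),t)$ be the position of a fixed particle of the sheet, $\sigma^*(t)=\ell_t(a^*)$ with $a^*\in I(0)$, and assume that $\Gamma(\sigma,t)=\int_{\sigma^*(t)}^{\sigma}\gamma(\sigma',t)|x_\sigma(\sigma',t)|\,d\sigma'$ is for every $t$ strictly increasing in $\sigma\in I(t)$. Then there are constants $-\infty<\Gamma_0<\Gamma_1<\infty$, independent of $t$, such that $(\Gamma_0,\Gamma_1)\subseteq\Gamma(I(t),t)\subseteq[\Gamma_0,\Gamma_1]$ for all $t$, and the curve parametrized by circulation, i.e. $x(\Gamma,t)$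 with $x(\Gamma(\sigma,t),t)=x(\sigma,t)$, satisfies for all $t$ and all $\Gamma$ in the range $\Gamma(I(t),t)$ the Birkhoff-Rott-$\alpha$ equation $$\frac{\partial}{\partial t}x(\Gamma,t)=\int_{\Gamma_0}^{\Gamma_1}K^\alpha\big(x(\Gamma,t)-x(\Gamma',t)\big)\,d\Gamma'.$$ Moreover, for every $t$ and a.e. $\Gamma\in(\Gamma_0,\Gamma_1)$, $x(\cdot,t)$ is differentiable at $\Gamma$ with $x_\Gamma\ne0$, and the density at the point $x(\Gamma,t)$ is $\gamma=1/|x_\Gamma|$. -/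

import Mathlib

open MeasureTheory Set
open scoped ContDiff Topology

/-- The Euclidean plane. -/
abbrev Plane : Type := EuclideanSpace ℝ (Fin 2)

/-- Rotation by a quarter turn, `(x₁, x₂)^⊥ = (-x₂, x₁)`. -/
def perp (x : Plane) : Plane := !₂[-x 1, x 0]

/-- The modified Bessel function of the second kind, for `r > 0`:
`K_ν(r) = ∫_0^∞ exp (-r cosh s) cosh (ν s) ds`. -/
noncomputable def besselK (ν r : ℝ) : ℝ :=
  ∫ s in Ioi (0 : ℝ), Real.exp (-(r * Real.cosh s)) * Real.cosh (ν * s)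

/-- `DΨ^α`, the radial derivative of `Ψ^α(r) = (K_0(r/α) + log r) / (2π)`. -/
noncomputable def radialDeriv (α r : ℝ) : ℝ :=
  1 / (2 * Real.pi) * (-(1 / α) * besselK 1 (r / α) + 1 / r)

/-- The smoothed Biot-Savart kernel `K^α(x) = ∇^⊥ Ψ^α(|x|) = DΨ^α(|x|) x^⊥ / |x|`.
Its value at `x = 0` is `0`, which is the continuous extension. -/
noncomputable def alphaKernel (α : ℝ) (x : Plane) : Plane :=
  (radialDeriv α ‖x‖ / ‖x‖) • perp x

/-- Global weak solutions of the two-dimensional Euler-`α` equations in vorticity form with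
initial vorticity a finite signed Radon measure: `η` is the Lagrangian flow map, `u` the filtered
velocity and `q` the vorticity. -/
structure IsEulerAlphaSolution (α : ℝ) (qin : SignedMeasure Plane)
    (η : ℝ → Plane ≃ₜ Plane) (u : ℝ → C(Plane, Plane)) (q : ℝ → SignedMeasure Plane) : Prop where
  /-- Each `η t` preserves the Lebesgue measure. -/
  flow_measurePreserving : ∀ t, MeasurePreserving (η t) volume volume
  /-- `t ↦ η t` is continuous for locally uniform convergence. -/
  flow_continuous : Continuous fun p : ℝ × Plane => η p.1 p.2
  /-- `η(y, 0) = y`. -/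
  flow_zero : ∀ y, η 0 y = y
  /-- `∂_t η(y, t) = u(η(y, t), t)`. -/
  flow_deriv : ∀ y t, HasDerivAt (fun s => η s y) (u t (η t y)) t
  /-- `u ∈ C(ℝ; C(ℝ²))`, for locally uniform convergence. -/
  velocity_continuous : Continuous u
  /-- `q ∈ C(ℝ; M(ℝ²))`, for the weak-* topology of `M(ℝ²) = C_0(ℝ²)*`. -/
  vorticity_continuous : ∀ φ : ZeroAtInftyContinuousMap Plane ℝ,
    Continuous fun t => ∫ᵛ y, φ y ∂<•(q t)
  /-- `u = K^α * q`. -/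
  velocity_eq : ∀ t y, u t y = ∫ᵛ z, alphaKernel α (y - z) ∂<•(q t)
  /-- `∂_t q + (u · ∇) q = 0` in the sense of distributions (`u` is divergence free):
  `∫ ∫ (∂_t ψ + u · ∇ψ) dq(t) dt = 0` for all test functions `ψ` on space-time. -/
  transport : ∀ ψ : ℝ × Plane → ℝ, ContDiff ℝ ∞ ψ → HasCompactSupport ψ →
    ∫ t : ℝ, (∫ᵛ y, fderiv ℝ ψ (t, y) (1, u t y) ∂<•(q t)) = 0
  /-- The initial condition. -/
  initial : q 0 = qin

/-- `|x_σ(σ, t)|`. -/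
noncomputable def arcSpeed (x : ℝ → ℝ → Plane) (σ t : ℝ) : ℝ := ‖deriv (fun s => x s t) σ‖

/-- The vorticity `q t` is carried by the curve `{x(σ, t) | σ ∈ I t}`, with density `γ(·, t)` with
respect to `|x_σ| dσ`. The parameter interval `I t`, with end points `σ₀(t) < σ₁(t)`, may
be bounded or unbounded and may depend on time. -/
structure IsVortexSheet (q : ℝ → SignedMeasure Plane) (I : ℝ → Set ℝ)
    (x : ℝ → ℝ → Plane) (γ : ℝ → ℝ → ℝ) : Prop where
  interval : ∀ t, (I t).OrdConnected
  nontrivial : ∀ t, (I t).Nontrivial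
  continuousOn : ∀ t, ContinuousOn (fun σ => x σ t) (I t)
  differentiable : ∀ t, ∀ᵐ σ ∂volume.restrict (I t), DifferentiableAt ℝ (fun s => x s t) σ
  /-- `γ(·, t) ∈ L¹(|x_σ| dσ)`. -/
  integrable : ∀ t, IntegrableOn (fun σ => γ σ t * arcSpeed x σ t) (I t)
  density : ∀ t, ∀ φ : Plane → ℝ, ContDiff ℝ ∞ φ → HasCompactSupport φ →
    ∫ᵛ y, φ y ∂<•(q t) = ∫ σ in I t, φ (x σ t) * (γ σ t * arcSpeed x σ t)

/-- `ℓ t a` is the parameter at time `t` of the fluid particle of the sheet that has parameter `a`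
at time `0`. If the parameter `σ` is itself a Lagrangian label, then `I t` does not depend on `t`
and `ℓ t a = a`. -/
structure IsLagrangianLabelling (η : ℝ → Plane ≃ₜ Plane) (I : ℝ → Set ℝ)
    (x : ℝ → ℝ → Plane) (ℓ : ℝ → ℝ → ℝ) : Prop where
  strictMonoOn : ∀ t, StrictMonoOn (ℓ t) (I 0)
  image_eq : ∀ t, ℓ t '' I 0 = I t
  transported : ∀ t, ∀ a ∈ I 0, x (ℓ t a) t = η t (x a 0)

/-- The integrand of the sheet velocity at `x(σ, t)`:
`σ' ↦ K^α(x(σ, t) - x(σ', t)) γ(σ', t) |x_σ(σ', t)|`. -/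
noncomputable def sheetIntegrand (α : ℝ) (x : ℝ → ℝ → Plane) (γ : ℝ → ℝ → ℝ)
    (σ t σ' : ℝ) : Plane :=
  (γ σ' t * arcSpeed x σ' t) • alphaKernel α (x σ t - x σ' t)

/-- The circulation `Γ(σ, t) = ∫_{σ*}^σ γ |x_σ| dσ'` between the points of parameters `σ*`
and `σ`. -/
noncomputable def circulation (x : ℝ → ℝ → Plane) (γ : ℝ → ℝ → ℝ) (σstar σ t : ℝ) : ℝ :=
  ∫ s in σstar..σ, γ s t * arcSpeed x s t

/-!
The whole statement rests on two facts about the filtered velocity `u = K^α * q`.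

*The kernel is bounded and log-Lipschitz.* From the integral representations of `1 / z` and `K_1(z)`,
`1 / z - K_1(z) = ∫_0^∞ cosh s (exp (-z sinh s) - exp (-z cosh s)) ds`. In this integral the part
`s ≤ S` is Lipschitz in `z` with constant `S`, and the part `s > S` is at most `exp (-S)`. This gives
`‖K^α(x) - K^α(y)‖ ≤ C (S ‖x - y‖ + exp (-S))` for every `S ≥ 0`
(`exists_norm_alphaKernel_sub_le`), which is the log-Lipschitz bound with a free parameter and the
form in which it is used throughout.

*The vorticity of the sheet is the difference of two finite measures carried by the curve*
(`eq_toSignedMeasure_curveMeasure_sub`), because finite measures are determined by test functions.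
As the kernel is bounded and continuous, `u` is the integral of the kernel over the curve
(`velocity_eq_setIntegral`). Together with `∂_t η = u(η)` this is the velocity of the particles and
the evolution equation of the sheet.

For the equation in the circulation variable, strict monotonicity of the circulation makes the
vorticity a nonnegative measure `μ_t`, and the point is that `μ_t` is transported by the flow
(`map_flow_symm_eq`). The flow map is merely Hölder continuous, so `φ ∘ η_t⁻¹` is not an admissible
test function. It is mollified at scale `ε = exp (-S)`, which amounts to testing the equation with
bumps that are centred at moving particles. The error is a commutator that involves
`u(y) - u(η_t(w))` for `|y - η_t(w)| ≤ ε`; since the flow preserves the Lebesgue measure, the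
commutator kernel has mean zero in `w` (`IsLogLipschitzFlow.integral_commutatorKernel`), so `φ(w)`
may be replaced by its difference from the value at the particle that sits at `y`. By Gronwall's
inequality the preimages of points at distance `ε` are at distance at most `2 ε exp (L S |t - t₀|)`.
The error is then of order `S exp (-S / 2)` on a time interval with `L |t - t₀| ≤ 1 / 2`
(`IsLogLipschitzFlow.map_symm_eq`), so that `(η_t⁻¹)_* μ_t` is locally constant in `t`. The constant
`L` is locally bounded in time because the mass of `μ_t` is, by the uniform boundedness principle.

Since the curve is simple, the circulation of an arc is its `μ_t`-measure, and hence the circulation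
between two particles is conserved (`circulation_conserved`). So the range of the circulation does
not depend on time, and a fixed value of the circulation follows a fixed particle. Finally the
circulation maps `γ |x_σ| dσ` to the Lebesgue measure (`map_circulation`), which turns the sheet
integral into `∫ dΓ'`. Its inverse maps the Lebesgue measure back to `γ |x_σ| dσ`, so that
properties that hold for almost every `σ` hold at almost every `Γ`
(`ae_hasDerivAt_circulationInv`).
-/

/-! ### The modulus of continuity of the kernel -/

/-- The integrand of `1 / z - K_1(z)`, from `1 / z = ∫_0^∞ cosh s exp (-z sinh s) ds`. -/
noncomputable def besselGapIntegrand (z s : ℝ) : ℝ :=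
  Real.cosh s * (Real.exp (-(z * Real.sinh s)) - Real.exp (-(z * Real.cosh s)))

/-- The function `1 / z - K_1(z)` for `z > 0`, extended by `0` at `z = 0`. -/
noncomputable def besselGap (z : ℝ) : ℝ := ∫ s in Ioi (0 : ℝ), besselGapIntegrand z s

lemma hasDerivAt_exp_neg_mul_sinh (z s : ℝ) (hz : z ≠ 0) :
    HasDerivAt (fun s => -(1 / z) * Real.exp (-(z * Real.sinh s)))
      (Real.cosh s * Real.exp (-(z * Real.sinh s))) s := by
  have h := ((((Real.hasDerivAt_sinh s).const_mul z).neg).exp).const_mul (-(1 / z))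
  refine h.congr_deriv ?_
  simp only [Pi.neg_apply]
  field_simp

lemma tendsto_sinh_atTop : Filter.Tendsto Real.sinh Filter.atTop Filter.atTop :=
  Filter.tendsto_atTop_mono' _ (by
    filter_upwards [Filter.eventually_ge_atTop 0] with s hs using Real.self_le_sinh_iff.2 hs)
    Filter.tendsto_id

lemma tendsto_exp_neg_mul_sinh {z : ℝ} (hz : 0 < z) :
    Filter.Tendsto (fun s => -(1 / z) * Real.exp (-(z * Real.sinh s))) Filter.atTop (𝓝 0) := by
  have h : Filter.Tendsto (fun s => z * Real.sinh s) Filter.atTop Filter.atTop :=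
    tendsto_sinh_atTop.const_mul_atTop hz
  simpa using (Real.tendsto_exp_neg_atTop_nhds_zero.comp h).const_mul (-(1 / z))

lemma integrableOn_cosh_mul_exp_sinh {z : ℝ} (hz : 0 < z) :
    IntegrableOn (fun s => Real.cosh s * Real.exp (-(z * Real.sinh s))) (Ioi 0) :=
  integrableOn_Ioi_deriv_of_nonneg' (fun s _ => hasDerivAt_exp_neg_mul_sinh z s hz.ne')
    (fun s _ => by positivity) (tendsto_exp_neg_mul_sinh hz)

lemma integral_cosh_mul_exp_sinh {z : ℝ} (hz : 0 < z) :
    ∫ s in Ioi (0 : ℝ), Real.cosh s * Real.exp (-(z * Real.sinh s)) = 1 / z := by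
  rw [integral_Ioi_of_hasDerivAt_of_tendsto' (fun s _ => hasDerivAt_exp_neg_mul_sinh z s hz.ne')
    (integrableOn_cosh_mul_exp_sinh hz) (tendsto_exp_neg_mul_sinh hz)]
  simp

lemma continuous_besselGapIntegrand (z : ℝ) : Continuous (besselGapIntegrand z) := by
  unfold besselGapIntegrand
  fun_prop

lemma besselGapIntegrand_nonneg {z s : ℝ} (hz : 0 ≤ z) : 0 ≤ besselGapIntegrand z s := by
  refine mul_nonneg (Real.cosh_pos s).le (sub_nonneg.2 (Real.exp_le_exp.2 ?_))
  have := mul_le_mul_of_nonneg_left (Real.sinh_lt_cosh s).le hz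
  linarith

lemma besselGapIntegrand_le {z s : ℝ} :
    besselGapIntegrand z s ≤
      z * Real.exp (-s) * (Real.cosh s * Real.exp (-(z * Real.sinh s))) := by
  have h1 : Real.exp (-(z * Real.cosh s))
      = Real.exp (-(z * Real.sinh s)) * Real.exp (-(z * Real.exp (-s))) := by
    rw [← Real.exp_add, ← Real.cosh_sub_sinh s]
    congr 1
    ring
  have h2 := Real.add_one_le_exp (-(z * Real.exp (-s)))
  have h3 : 0 < Real.cosh s * Real.exp (-(z * Real.sinh s)) := by positivity
  unfold besselGapIntegrand
  rw [h1]
  nlinarith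

lemma besselGapIntegrand_le' {z s : ℝ} :
    besselGapIntegrand z s ≤ Real.cosh s * Real.exp (-(z * Real.sinh s)) := by
  unfold besselGapIntegrand
  have : 0 < Real.cosh s * Real.exp (-(z * Real.cosh s)) := by positivity
  nlinarith

lemma integrableOn_besselGapIntegrand {z : ℝ} (hz : 0 ≤ z) :
    IntegrableOn (besselGapIntegrand z) (Ioi 0) := by
  rcases hz.eq_or_lt with rfl | hz
  · have : besselGapIntegrand 0 = 0 := by ext s; simp [besselGapIntegrand]
    rw [this]
    exact integrableOn_zero
  · refine (integrableOn_cosh_mul_exp_sinh hz).mono'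
      (continuous_besselGapIntegrand z).aestronglyMeasurable (ae_of_all _ fun s => ?_)
    rw [Real.norm_of_nonneg (besselGapIntegrand_nonneg hz.le)]
    exact besselGapIntegrand_le'

lemma besselGap_eq {z : ℝ} (hz : 0 < z) : besselGap z = 1 / z - besselK 1 z := by
  have h1 : IntegrableOn (fun s => Real.cosh s * Real.exp (-(z * Real.cosh s))) (Ioi 0) := by
    refine (integrableOn_cosh_mul_exp_sinh hz).mono' (by fun_prop) (ae_of_all _ fun s => ?_)
    rw [Real.norm_of_nonneg (by positivity)]
    gcongr
    exact (Real.sinh_lt_cosh s).le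
  rw [← integral_cosh_mul_exp_sinh hz, besselK]
  have h2 : ∀ s, Real.exp (-(z * Real.cosh s)) * Real.cosh (1 * s)
      = Real.cosh s * Real.exp (-(z * Real.cosh s)) := fun s => by rw [one_mul, mul_comm]
  simp_rw [h2]
  rw [← integral_sub (integrableOn_cosh_mul_exp_sinh hz) h1]
  simp_rw [besselGap, besselGapIntegrand, mul_sub]

lemma besselGap_tail_nonneg {z S : ℝ} (hz : 0 ≤ z) :
    0 ≤ ∫ s in Ioi S, besselGapIntegrand z s :=
  integral_nonneg fun _ => besselGapIntegrand_nonneg hz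

lemma besselGap_tail_le {z S : ℝ} (hz : 0 ≤ z) (hS : 0 ≤ S) :
    ∫ s in Ioi S, besselGapIntegrand z s ≤ Real.exp (-S) := by
  rcases hz.eq_or_lt with rfl | hz
  · simp [besselGapIntegrand, Real.exp_nonneg]
  have hsub : Ioi S ⊆ Ioi (0 : ℝ) := Ioi_subset_Ioi hS
  have hint := (integrableOn_cosh_mul_exp_sinh hz).const_mul (z * Real.exp (-S))
  calc ∫ s in Ioi S, besselGapIntegrand z s
      ≤ ∫ s in Ioi S, z * Real.exp (-S) * (Real.cosh s * Real.exp (-(z * Real.sinh s))) := by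
        refine setIntegral_mono_on ((integrableOn_besselGapIntegrand hz.le).mono_set hsub)
          (IntegrableOn.mono_set hint hsub) measurableSet_Ioi fun s hs => ?_
        refine besselGapIntegrand_le.trans ?_
        gcongr
        exact (mem_Ioi.1 hs).le
    _ ≤ ∫ s in Ioi (0 : ℝ), z * Real.exp (-S) * (Real.cosh s * Real.exp (-(z * Real.sinh s))) :=
        setIntegral_mono_set hint (ae_of_all _ fun s => by positivity) hsub.eventuallyLE
    _ = Real.exp (-S) := by
        rw [integral_const_mul, integral_cosh_mul_exp_sinh hz]
        field_simp

lemma abs_one_sub_mul_exp_neg_le {w : ℝ} (hw : 0 ≤ w) : |(1 - w) * Real.exp (-w)| ≤ 1 := by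
  rw [abs_mul, abs_of_pos (Real.exp_pos _), Real.exp_neg, ← div_eq_mul_inv,
    div_le_one (Real.exp_pos _), abs_le]
  have := Real.add_one_le_exp w
  constructor <;> linarith

lemma abs_mul_exp_neg_sub_le {z v w : ℝ} (hz : 0 ≤ z) (hv : 0 ≤ v) (hw : 0 ≤ w) :
    |v * Real.exp (-(z * v)) - w * Real.exp (-(z * w))| ≤ |v - w| := by
  have h : ∀ y ∈ Ici (0 : ℝ), HasDerivWithinAt (fun y => y * Real.exp (-(z * y)))
      ((1 - z * y) * Real.exp (-(z * y))) (Ici 0) y := fun y _ => by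
    have := (hasDerivAt_id y).mul (((hasDerivAt_id y).const_mul z).neg.exp)
    refine (this.congr_deriv ?_).hasDerivWithinAt
    simp
    ring
  have := (convex_Ici (0 : ℝ)).norm_image_sub_le_of_norm_hasDerivWithin_le (C := 1) h
    (fun y hy => abs_one_sub_mul_exp_neg_le (mul_nonneg hz hy)) hw hv
  simpa using this

lemma abs_besselGapIntegrand_sub_le {a b s : ℝ} (ha : 0 ≤ a) (hb : 0 ≤ b) (hs : 0 ≤ s) :
    |besselGapIntegrand a s - besselGapIntegrand b s| ≤ |a - b| := by
  have h : ∀ z ∈ Ici (0 : ℝ), HasDerivWithinAt (fun z => besselGapIntegrand z s)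
      (Real.cosh s * (Real.cosh s * Real.exp (-(z * Real.cosh s)) -
        Real.sinh s * Real.exp (-(z * Real.sinh s)))) (Ici 0) z := fun z _ => by
    have h1 : ∀ v : ℝ, HasDerivAt (fun z => Real.exp (-(z * v))) (-v * Real.exp (-(z * v))) z :=
      fun v => (((hasDerivAt_id z).mul_const v).neg.exp).congr_deriv (by simp; ring)
    refine ((((h1 (Real.sinh s)).sub (h1 (Real.cosh s))).const_mul
      (Real.cosh s)).congr_deriv ?_).hasDerivWithinAt
    ring
  have hbd : ∀ z ∈ Ici (0 : ℝ), ‖Real.cosh s * (Real.cosh s * Real.exp (-(z * Real.cosh s)) -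
        Real.sinh s * Real.exp (-(z * Real.sinh s)))‖ ≤ 1 := fun z hz => by
    have h2 := abs_mul_exp_neg_sub_le hz (Real.cosh_pos s).le (Real.sinh_nonneg_iff.2 hs)
    rw [Real.cosh_sub_sinh, abs_of_pos (Real.exp_pos _)] at h2
    rw [norm_mul, Real.norm_of_nonneg (Real.cosh_pos s).le]
    calc _ ≤ Real.cosh s * Real.exp (-s) := by
            gcongr
            exact h2
      _ ≤ Real.exp s * Real.exp (-s) := by
            gcongr
            rw [← Real.cosh_add_sinh]
            linarith [Real.sinh_nonneg_iff.2 hs]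
      _ = 1 := by rw [← Real.exp_add]; simp
  simpa using (convex_Ici (0 : ℝ)).norm_image_sub_le_of_norm_hasDerivWithin_le h hbd hb ha

/-- The log-Lipschitz bound of `1 / z - K_1(z)`, in a form with a free parameter `S`: the part
`s ≤ S` of the integral is Lipschitz with constant `S`, the part `s > S` is at most `exp (-S)`. -/
lemma abs_besselGap_sub_le {a b S : ℝ} (ha : 0 ≤ a) (hb : 0 ≤ b) (hS : 0 ≤ S) :
    |besselGap a - besselGap b| ≤ S * |a - b| + Real.exp (-S) := by
  have hsplit : ∀ z : ℝ, 0 ≤ z → besselGap z =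
      (∫ s in Ioc 0 S, besselGapIntegrand z s) + ∫ s in Ioi S, besselGapIntegrand z s := by
    intro z hz
    have hi := integrableOn_besselGapIntegrand hz
    rw [besselGap, ← Ioc_union_Ioi_eq_Ioi hS]
    exact setIntegral_union Ioc_disjoint_Ioi_same measurableSet_Ioi
      (hi.mono_set Ioc_subset_Ioi_self) (hi.mono_set (Ioi_subset_Ioi hS))
  have h1 : |(∫ s in Ioc 0 S, besselGapIntegrand a s) - ∫ s in Ioc 0 S, besselGapIntegrand b s|
      ≤ S * |a - b| := by
    rw [← integral_sub ((integrableOn_besselGapIntegrand ha).mono_set Ioc_subset_Ioi_self)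
      ((integrableOn_besselGapIntegrand hb).mono_set Ioc_subset_Ioi_self)]
    have := norm_setIntegral_le_of_norm_le_const (μ := volume) (s := Ioc 0 S) (C := |a - b|)
      (f := fun s => besselGapIntegrand a s - besselGapIntegrand b s) (by simp)
      (fun s hs => abs_besselGapIntegrand_sub_le ha hb hs.1.le)
    simpa [Measure.real, hS, mul_comm] using this
  have h2 : |(∫ s in Ioi S, besselGapIntegrand a s) - ∫ s in Ioi S, besselGapIntegrand b s|
      ≤ Real.exp (-S) :=
    abs_sub_le_of_nonneg_of_le (besselGap_tail_nonneg ha) (besselGap_tail_le ha hS)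
      (besselGap_tail_nonneg hb) (besselGap_tail_le hb hS)
  rw [hsplit a ha, hsplit b hb, add_sub_add_comm]
  exact (abs_add_le _ _).trans (add_le_add h1 h2)

lemma besselGap_zero : besselGap 0 = 0 := by simp [besselGap, besselGapIntegrand]

lemma abs_besselGap_le {a S : ℝ} (ha : 0 ≤ a) (hS : 0 ≤ S) :
    |besselGap a| ≤ S * a + Real.exp (-S) := by
  simpa [besselGap_zero, abs_of_nonneg ha] using abs_besselGap_sub_le ha le_rfl hS

lemma perp_sub (x y : Plane) : perp (x - y) = perp x - perp y := by
  ext i; fin_cases i <;> simp [perp]; ring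

lemma perp_smul (c : ℝ) (x : Plane) : perp (c • x) = c • perp x := by
  ext i; fin_cases i <;> simp [perp]

lemma norm_perp (x : Plane) : ‖perp x‖ = ‖x‖ := by
  simp [EuclideanSpace.norm_eq, perp, add_comm]

lemma alphaKernel_eq {α : ℝ} (hα : 0 < α) (x : Plane) :
    alphaKernel α x =
      (1 / (2 * Real.pi * α)) • (besselGap (‖x‖ / α) • perp ((1 / ‖x‖) • x)) := by
  rcases eq_or_ne x 0 with rfl | hx
  · have : perp 0 = 0 := by simpa using norm_perp 0
    simp [alphaKernel, this]
  · have hx' : 0 < ‖x‖ := norm_pos_iff.2 hx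
    rw [alphaKernel, radialDeriv, besselGap_eq (by positivity), perp_smul, smul_smul, smul_smul]
    congr 1
    field_simp
    ring

lemma norm_unit_sub_le {x y : Plane} (hx : x ≠ 0) (hy : y ≠ 0) :
    ‖(1 / ‖y‖) • y - (1 / ‖x‖) • x‖ ≤ 2 * ‖y - x‖ / ‖y‖ := by
  have hx' : 0 < ‖x‖ := norm_pos_iff.2 hx
  have hy' : 0 < ‖y‖ := norm_pos_iff.2 hy
  have h : (1 / ‖y‖) • y - (1 / ‖x‖) • x
      = (1 / ‖y‖) • (y - x) + ((‖x‖ - ‖y‖) / (‖y‖ * ‖x‖)) • x := by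
    have : (‖x‖ - ‖y‖) / (‖y‖ * ‖x‖) = 1 / ‖y‖ - 1 / ‖x‖ := by field_simp
    rw [this]
    module
  rw [h]
  refine (norm_add_le _ _).trans ?_
  rw [norm_smul, norm_smul]
  have h2 : |‖x‖ - ‖y‖| ≤ ‖y - x‖ := by
    rw [norm_sub_rev]; exact abs_norm_sub_norm_le x y
  rw [Real.norm_of_nonneg (by positivity : 0 ≤ 1 / ‖y‖), norm_div, Real.norm_eq_abs,
    Real.norm_of_nonneg (by positivity : 0 ≤ ‖y‖ * ‖x‖)]
  have : |‖x‖ - ‖y‖| / (‖y‖ * ‖x‖) * ‖x‖ = |‖x‖ - ‖y‖| / ‖y‖ := by field_simp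
  rw [this]
  have : |‖x‖ - ‖y‖| / ‖y‖ ≤ ‖y - x‖ / ‖y‖ := by gcongr
  calc _ ≤ 1 / ‖y‖ * ‖y - x‖ + ‖y - x‖ / ‖y‖ := by gcongr
    _ = _ := by ring

/-- The modulus of continuity passes from `besselGap` to the vector field. For `‖x‖ ≤ ‖y‖` the
directions differ by at most `min 2 (2 ‖x - y‖ / ‖y‖)`, while `besselGap` at `x` is at most
`S ‖x‖ / α + exp (-S)`: the first bound serves for `exp (-S)`, the second for `S ‖x‖ / α`. -/
lemma norm_smul_unit_sub_le {α S : ℝ} (hα : 0 < α) (hS : 0 ≤ S) (x y : Plane) :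
    ‖besselGap (‖x‖ / α) • perp ((1 / ‖x‖) • x) - besselGap (‖y‖ / α) • perp ((1 / ‖y‖) • y)‖
      ≤ 3 * (S * (‖x - y‖ / α) + Real.exp (-S)) := by
  wlog hxy : ‖x‖ ≤ ‖y‖ generalizing x y
  · rw [norm_sub_rev, norm_sub_rev x]
    exact this y x (le_of_not_ge hxy)
  have hpos : 0 ≤ S * (‖x - y‖ / α) := by positivity
  rcases eq_or_ne y 0 with rfl | hy
  · have : x = 0 := by simpa using hxy
    subst this
    simp [Real.exp_nonneg]
  have hy' : 0 < ‖y‖ := norm_pos_iff.2 hy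
  have hunit : ∀ z : Plane, ‖(1 / ‖z‖) • z‖ ≤ 1 := fun z => by
    rw [norm_smul, norm_div, norm_norm, norm_one, one_div]
    exact inv_mul_le_one
  have hdiff : |besselGap (‖x‖ / α) - besselGap (‖y‖ / α)|
      ≤ S * (‖x - y‖ / α) + Real.exp (-S) := by
    refine (abs_besselGap_sub_le (by positivity) (by positivity) hS).trans ?_
    rw [← sub_div, abs_div, abs_of_pos hα]
    gcongr
    exact abs_norm_sub_norm_le x y
  have hdecomp : besselGap (‖x‖ / α) • perp ((1 / ‖x‖) • x)
        - besselGap (‖y‖ / α) • perp ((1 / ‖y‖) • y)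
      = (besselGap (‖x‖ / α) - besselGap (‖y‖ / α)) • perp ((1 / ‖y‖) • y)
        - besselGap (‖x‖ / α) • perp ((1 / ‖y‖) • y - (1 / ‖x‖) • x) := by
    rw [perp_sub]
    module
  rw [hdecomp]
  refine (norm_sub_le _ _).trans ?_
  rw [norm_smul, norm_smul, norm_perp, norm_perp, Real.norm_eq_abs, Real.norm_eq_abs]
  have h1 : |besselGap (‖x‖ / α) - besselGap (‖y‖ / α)| * ‖(1 / ‖y‖) • y‖
      ≤ S * (‖x - y‖ / α) + Real.exp (-S) := by
    calc _ ≤ |besselGap (‖x‖ / α) - besselGap (‖y‖ / α)| * 1 := by gcongr; exact hunit y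
      _ ≤ _ := by rw [mul_one]; exact hdiff
  have h2 : |besselGap (‖x‖ / α)| * ‖(1 / ‖y‖) • y - (1 / ‖x‖) • x‖
      ≤ 2 * (S * (‖x - y‖ / α)) + 2 * Real.exp (-S) := by
    rcases eq_or_ne x 0 with rfl | hx
    · simp only [norm_zero, zero_div, besselGap_zero, abs_zero, zero_mul]
      positivity
    have hu1 : ‖(1 / ‖y‖) • y - (1 / ‖x‖) • x‖ ≤ 2 * ‖x - y‖ / ‖y‖ := by
      rw [norm_sub_rev x y]; exact norm_unit_sub_le hx hy
    have hu2 : ‖(1 / ‖y‖) • y - (1 / ‖x‖) • x‖ ≤ 2 :=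
      (norm_sub_le _ _).trans (by linarith [hunit x, hunit y])
    calc _ ≤ (S * (‖x‖ / α) + Real.exp (-S)) * ‖(1 / ‖y‖) • y - (1 / ‖x‖) • x‖ := by
            gcongr
            exact abs_besselGap_le (by positivity) hS
      _ ≤ S * (‖y‖ / α) * (2 * ‖x - y‖ / ‖y‖) + Real.exp (-S) * 2 := by
            rw [add_mul]
            gcongr
      _ = _ := by field_simp
  linarith

/-- The log-Lipschitz modulus of continuity of `K^α`, with the free parameter `S`. -/
lemma exists_norm_alphaKernel_sub_le {α : ℝ} (hα : 0 < α) :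
    ∃ C : ℝ, 0 < C ∧ ∀ S : ℝ, 0 ≤ S → ∀ x y : Plane,
      ‖alphaKernel α x - alphaKernel α y‖ ≤ C * (S * ‖x - y‖ + Real.exp (-S)) := by
  refine ⟨1 / (2 * Real.pi * α) * 3 * (1 / α + 1), by positivity, fun S hS x y => ?_⟩
  rw [alphaKernel_eq hα, alphaKernel_eq hα, ← smul_sub, norm_smul,
    Real.norm_of_nonneg (by positivity)]
  refine (mul_le_mul_of_nonneg_left (norm_smul_unit_sub_le hα hS x y)
    (by positivity : (0 : ℝ) ≤ 1 / (2 * Real.pi * α))).trans ?_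
  rw [mul_assoc (1 / (2 * Real.pi * α)), mul_assoc (1 / (2 * Real.pi * α)), mul_assoc 3]
  have h1 : 0 ≤ S * ‖x - y‖ := by positivity
  have h2 : 0 ≤ 1 / α * Real.exp (-S) := by positivity
  have h3 : S * (‖x - y‖ / α) = 1 / α * (S * ‖x - y‖) := by ring
  gcongr
  rw [h3]
  nlinarith

lemma alphaKernel_zero (α : ℝ) : alphaKernel α 0 = 0 := by
  simp [alphaKernel, perp]

lemma exists_norm_alphaKernel_le {α : ℝ} (hα : 0 < α) :
    ∃ C : ℝ, 0 < C ∧ ∀ x : Plane, ‖alphaKernel α x‖ ≤ C := by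
  obtain ⟨C, hC, h⟩ := exists_norm_alphaKernel_sub_le hα
  exact ⟨C, hC, fun x => by simpa [alphaKernel_zero] using h 0 le_rfl x 0⟩

lemma continuous_alphaKernel {α : ℝ} (hα : 0 < α) : Continuous (alphaKernel α) := by
  obtain ⟨C, hC, h⟩ := exists_norm_alphaKernel_sub_le hα
  rw [continuous_iff_continuousAt]
  intro x
  rw [ContinuousAt, tendsto_iff_norm_sub_tendsto_zero]
  rw [Metric.tendsto_nhds]
  intro ε hε
  obtain ⟨S, hS, hS0⟩ : ∃ S : ℝ, C * Real.exp (-S) < ε / 2 ∧ 0 ≤ S := by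
    have h1 : Filter.Tendsto (fun S : ℝ => C * Real.exp (-S)) Filter.atTop (𝓝 0) := by
      simpa using Real.tendsto_exp_neg_atTop_nhds_zero.const_mul C
    exact ((h1.eventually_lt_const (half_pos hε)).and (Filter.eventually_ge_atTop 0)).exists
  have h2 : Filter.Tendsto (fun y => C * (S * ‖y - x‖)) (𝓝 x) (𝓝 0) := by
    have : Continuous fun y => C * (S * ‖y - x‖) := by fun_prop
    simpa using this.tendsto x
  filter_upwards [h2.eventually_lt_const (half_pos hε)] with y hy
  rw [dist_zero_right, norm_norm]
  have := h S hS0 y x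
  rw [mul_add] at this
  linarith

/-! ### Signed measures tested against smooth functions -/

lemma contDiff_smoothTransition_sub_normSq (n : ℝ) :
    ContDiff ℝ ∞ fun y : Plane => Real.smoothTransition (n - ‖y‖ ^ 2) :=
  Real.smoothTransition.contDiff.comp (contDiff_const.sub (contDiff_norm_sq ℝ))

lemma hasCompactSupport_smoothTransition_sub_normSq (n : ℝ) :
    HasCompactSupport fun y : Plane => Real.smoothTransition (n - ‖y‖ ^ 2) := by
  refine HasCompactSupport.of_support_subset_isCompact
    (isCompact_closedBall (0 : Plane) (|n| + 1)) fun y hy => ?_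
  by_contra hlt
  rw [mem_closedBall_zero_iff, not_le] at hlt
  refine hy (Real.smoothTransition.zero_of_nonpos ?_)
  nlinarith [le_abs_self n, abs_nonneg n]

lemma tendsto_smoothTransition_sub_normSq (y : Plane) :
    Filter.Tendsto (fun n : ℕ => Real.smoothTransition ((n : ℝ) - ‖y‖ ^ 2)) Filter.atTop (𝓝 1) := by
  refine tendsto_const_nhds.congr' ?_
  filter_upwards [Filter.eventually_ge_atTop ⌈‖y‖ ^ 2 + 1⌉₊] with n hn
  have h := (Nat.le_ceil (‖y‖ ^ 2 + 1)).trans (Nat.cast_le.2 hn)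
  exact (Real.smoothTransition.one_of_one_le (by linarith)).symm

/-- Finite measures on the plane are determined by the integrals of test functions. -/
theorem measure_ext_of_integral_contDiff {A B : Measure Plane} [IsFiniteMeasure A]
    [IsFiniteMeasure B] (h : ∀ φ : Plane → ℝ, ContDiff ℝ ∞ φ → HasCompactSupport φ →
      ∫ y, φ y ∂A = ∫ y, φ y ∂B) : A = B := by
  have key : ∀ U : Set Plane, IsOpen U → A U = B U := by
    intro U hU
    obtain ⟨f, hfU, hf, hf01⟩ := hU.exists_contDiff_support_eq (n := ⊤)
    -- smooth functions with compact support that converge to the indicator function of `U`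
    let φ : ℕ → Plane → ℝ := fun n y =>
      Real.smoothTransition (n * f y) * Real.smoothTransition (n - ‖y‖ ^ 2)
    have hφ : ∀ n, ContDiff ℝ ∞ (φ n) := fun n =>
      (Real.smoothTransition.contDiff.comp (contDiff_const.mul hf)).mul
        (contDiff_smoothTransition_sub_normSq n)
    have hlim : ∀ y, Filter.Tendsto (fun n => φ n y) Filter.atTop (𝓝 (U.indicator 1 y)) := by
      intro y
      have h2 := tendsto_smoothTransition_sub_normSq y
      by_cases hy : y ∈ U
      · have hpos : 0 < f y := (hf01 (mem_range_self y)).1.lt_of_ne' (by rwa [← hfU] at hy)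
        have h1 : Filter.Tendsto (fun n : ℕ => Real.smoothTransition (n * f y)) Filter.atTop
            (𝓝 1) := by
          refine tendsto_const_nhds.congr' ?_
          have h3 : Filter.Tendsto (fun n : ℕ => (n : ℝ) * f y) Filter.atTop Filter.atTop :=
            tendsto_natCast_atTop_atTop.atTop_mul_const hpos
          filter_upwards [h3.eventually_ge_atTop 1] with n hn
          exact (Real.smoothTransition.one_of_one_le hn).symm
        simpa [hy] using h1.mul h2
      · have : f y = 0 := by rwa [← hfU, Function.notMem_support] at hy
        simp [hy, φ, this, Real.smoothTransition.zero]
    have hbd : ∀ n y, ‖φ n y‖ ≤ 1 := fun n y => by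
      rw [Real.norm_of_nonneg (mul_nonneg (Real.smoothTransition.nonneg _)
        (Real.smoothTransition.nonneg _))]
      exact mul_le_one₀ (Real.smoothTransition.le_one _) (Real.smoothTransition.nonneg _)
        (Real.smoothTransition.le_one _)
    have hD : ∀ (D : Measure Plane) [IsFiniteMeasure D],
        Filter.Tendsto (fun n => ∫ y, φ n y ∂D) Filter.atTop (𝓝 (D.real U)) := by
      intro D _
      rw [← integral_indicator_one hU.measurableSet]
      exact tendsto_integral_of_dominated_convergence (fun _ => 1)
        (fun n => (hφ n).continuous.aestronglyMeasurable) (integrable_const _)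
        (fun n => ae_of_all _ (hbd n)) (ae_of_all _ hlim)
    have hAB : A.real U = B.real U := by
      refine tendsto_nhds_unique (hD A) ((hD B).congr fun n => ?_)
      exact (h _ (hφ n)
        (hasCompactSupport_smoothTransition_sub_normSq n).mul_left).symm
    exact (measureReal_eq_measureReal_iff).1 hAB
  exact ext_of_generate_finite _ (BorelSpace.measurable_eq (α := Plane)) isPiSystem_isOpen
    (fun U hU => key U hU) (key univ isOpen_univ)

lemma integral_toSignedMeasure_sub {X G : Type*} [MeasurableSpace X] [NormedAddCommGroup G]
    [NormedSpace ℝ G] {A B : Measure X} [IsFiniteMeasure A] [IsFiniteMeasure B] {f : X → G}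
    (hA : Integrable f A) (hB : Integrable f B) :
    ∫ᵛ y, f y ∂<•(A.toSignedMeasure - B.toSignedMeasure) = ∫ y, f y ∂A - ∫ y, f y ∂B := by
  rw [VectorMeasure.integral_sub_vectorMeasure, VectorMeasure.integral_toSignedMeasure,
    VectorMeasure.integral_toSignedMeasure]
  · rwa [VectorMeasure.Integrable, Measure.variation_toSignedMeasure]
  · rwa [VectorMeasure.Integrable, Measure.variation_toSignedMeasure]

/-! ### Measures carried by a curve -/

/-- The image under `x` of the measure `max (w σ) 0 dσ` on `I`. -/
noncomputable def curveMeasure (I : Set ℝ) (x : ℝ → Plane) (w : ℝ → ℝ) : Measure Plane :=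
  ((volume.restrict I).withDensity fun σ => ENNReal.ofReal (w σ)).map x

lemma isFiniteMeasure_curveMeasure {I : Set ℝ} {x : ℝ → Plane} {w : ℝ → ℝ}
    (hw : IntegrableOn w I) : IsFiniteMeasure (curveMeasure I x w) := by
  have := isFiniteMeasure_withDensity_ofReal hw.2
  exact Measure.isFiniteMeasure_map _ _

section
variable {E : Type*} [NormedAddCommGroup E] [NormedSpace ℝ E] {I : Set ℝ} {x : ℝ → Plane}
  {w : ℝ → ℝ}

lemma integral_curveMeasure (hI : MeasurableSet I) (hx : ContinuousOn x I)
    (hw : IntegrableOn w I) {f : Plane → E} (hf : StronglyMeasurable f) :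
    ∫ y, f y ∂(curveMeasure I x w) = ∫ σ in I, max (w σ) 0 • f (x σ) := by
  have hx' : AEMeasurable x
      ((volume.restrict I).withDensity fun σ => ENNReal.ofReal (w σ)) :=
    (hx.aemeasurable hI).mono_ac (withDensity_absolutelyContinuous _ _)
  rw [curveMeasure, integral_map hx' hf.aestronglyMeasurable,
    integral_withDensity_eq_integral_toReal_smul₀ hw.aemeasurable.ennreal_ofReal
      (ae_of_all _ fun σ => ENNReal.ofReal_lt_top)]
  simp_rw [ENNReal.toReal_ofReal']

lemma integrableOn_smul_comp_of_bounded (hI : MeasurableSet I) (hx : ContinuousOn x I)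
    (hw : IntegrableOn w I) {f : Plane → E} (hf : Continuous f) {C : ℝ} (hC : ∀ y, ‖f y‖ ≤ C) :
    IntegrableOn (fun σ => w σ • f (x σ)) I :=
  hw.smul_bdd C
    ((hf.comp_continuousOn hx).aestronglyMeasurable hI) (ae_of_all _ fun _ => hC _)

lemma integral_curveMeasure_sub (hI : MeasurableSet I) (hx : ContinuousOn x I)
    (hw : IntegrableOn w I) {f : Plane → E} (hf : Continuous f) {C : ℝ}
    (hC : ∀ y, ‖f y‖ ≤ C) :
    ∫ y, f y ∂(curveMeasure I x w) - ∫ y, f y ∂(curveMeasure I x fun σ => -w σ) =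
      ∫ σ in I, w σ • f (x σ) := by
  rw [integral_curveMeasure hI hx hw hf.stronglyMeasurable,
    integral_curveMeasure hI hx (w := fun σ => -w σ) hw.neg hf.stronglyMeasurable, ← integral_sub
    (integrableOn_smul_comp_of_bounded hI hx hw.pos_part hf hC)
    (integrableOn_smul_comp_of_bounded hI hx hw.neg_part hf hC)]
  congr 1 with σ
  rw [← sub_smul, max_zero_sub_max_neg_zero_eq_self]

end

/-- A signed measure that acts on test functions like the curve with density `w` is the difference
of the two nonnegative measures that the curve carries. -/
theorem eq_toSignedMeasure_curveMeasure_sub {I : Set ℝ} {x : ℝ → Plane} {w : ℝ → ℝ}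
    (hI : MeasurableSet I) (hx : ContinuousOn x I) (hw : IntegrableOn w I)
    [IsFiniteMeasure (curveMeasure I x w)] [IsFiniteMeasure (curveMeasure I x fun σ => -w σ)]
    {q : SignedMeasure Plane}
    (h : ∀ φ : Plane → ℝ, ContDiff ℝ ∞ φ → HasCompactSupport φ →
      ∫ᵛ y, φ y ∂<•q = ∫ σ in I, φ (x σ) * w σ) :
    q = (curveMeasure I x w).toSignedMeasure
      - (curveMeasure I x fun σ => -w σ).toSignedMeasure := by
  have hq := q.toSignedMeasure_toJordanDecomposition
  rw [JordanDecomposition.toSignedMeasure] at hq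
  set j := q.toJordanDecomposition
  set A := curveMeasure I x w
  set B := curveMeasure I x fun σ => -w σ
  -- both sides are finite nonnegative measures, so they can be compared on test functions
  have hAB : j.posPart + B = A + j.negPart := by
    refine measure_ext_of_integral_contDiff fun φ hφ hφc => ?_
    obtain ⟨C, hC⟩ := hφc.exists_bound_of_continuous hφ.continuous
    have hint : ∀ (D : Measure Plane) [IsFiniteMeasure D], Integrable φ D := fun D _ =>
      hφ.continuous.integrable_of_hasCompactSupport hφc
    have h1 := h φ hφ hφc
    rw [← hq, integral_toSignedMeasure_sub (hint _) (hint _)] at h1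
    have h2 := integral_curveMeasure_sub hI hx hw hφ.continuous hC
    simp_rw [smul_eq_mul, mul_comm (w _)] at h2
    rw [← h2] at h1
    rw [integral_add_measure (hint _) (hint _), integral_add_measure (hint _) (hint _)]
    linarith
  have h3 := Measure.toSignedMeasure_congr hAB
  rw [Measure.toSignedMeasure_add, Measure.toSignedMeasure_add] at h3
  rw [← hq, sub_eq_sub_iff_add_eq_add, h3]

lemma IsVortexSheet.measurableSet {q : ℝ → SignedMeasure Plane} {I : ℝ → Set ℝ}
    {x : ℝ → ℝ → Plane} {γ : ℝ → ℝ → ℝ} (h : IsVortexSheet q I x γ) (t : ℝ) :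
    MeasurableSet (I t) :=
  (h.interval t).measurableSet

/-- The velocity field is the integral of the kernel over the curve. -/
theorem velocity_eq_setIntegral {α : ℝ} (hα : 0 < α) {qin : SignedMeasure Plane}
    {η : ℝ → Plane ≃ₜ Plane} {u : ℝ → C(Plane, Plane)} {q : ℝ → SignedMeasure Plane}
    (hsol : IsEulerAlphaSolution α qin η u q) {I : ℝ → Set ℝ} {x : ℝ → ℝ → Plane}
    {γ : ℝ → ℝ → ℝ} (hsheet : IsVortexSheet q I x γ) (t : ℝ) (y : Plane) :
    u t y = ∫ σ in I t, (γ σ t * arcSpeed x σ t) • alphaKernel α (y - x σ t) := by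
  obtain ⟨C, -, hC⟩ := exists_norm_alphaKernel_le hα
  have hI := hsheet.measurableSet t
  have hx := hsheet.continuousOn t
  have hw := hsheet.integrable t
  have hK : Continuous fun z => alphaKernel α (y - z) :=
    (continuous_alphaKernel hα).comp (continuous_const.sub continuous_id)
  have := isFiniteMeasure_curveMeasure (x := fun σ => x σ t) hw
  have := isFiniteMeasure_curveMeasure (x := fun σ => x σ t) hw.neg
  have hint : ∀ (D : Measure Plane) [IsFiniteMeasure D],
      Integrable (fun z => alphaKernel α (y - z)) D := fun D _ =>
    Integrable.of_bound hK.aestronglyMeasurable C (ae_of_all _ fun z => hC _)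
  rw [hsol.velocity_eq, eq_toSignedMeasure_curveMeasure_sub hI hx hw (hsheet.density t),
    integral_toSignedMeasure_sub (hint _) (hint _)]
  exact integral_curveMeasure_sub hI hx hw hK (fun z => hC _)

lemma integrableOn_sheetIntegrand {α : ℝ} (hα : 0 < α) {q : ℝ → SignedMeasure Plane}
    {I : ℝ → Set ℝ} {x : ℝ → ℝ → Plane} {γ : ℝ → ℝ → ℝ} (hsheet : IsVortexSheet q I x γ)
    (σ t : ℝ) : IntegrableOn (sheetIntegrand α x γ σ t) (I t) := by
  obtain ⟨C, -, hC⟩ := exists_norm_alphaKernel_le hα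
  exact integrableOn_smul_comp_of_bounded (hsheet.measurableSet t) (hsheet.continuousOn t)
    (hsheet.integrable t) (f := fun z => alphaKernel α (x σ t - z))
    ((continuous_alphaKernel hα).comp (continuous_const.sub continuous_id)) fun z => hC _

/-! ### Weak-* continuous families of measures -/

section
variable {μ : ℝ → Measure Plane} [∀ t, IsFiniteMeasure (μ t)]

/-- By the uniform boundedness principle, a weak-* continuous family of finite measures has
locally bounded mass. -/
theorem exists_measureReal_univ_le
    (hcont : ∀ φ : ZeroAtInftyContinuousMap Plane ℝ, Continuous fun t => ∫ y, φ y ∂(μ t))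
    (a b : ℝ) : ∃ M : ℝ, 0 ≤ M ∧ ∀ t ∈ Icc a b, (μ t).real univ ≤ M := by
  have hle : ∀ (φ : ZeroAtInftyContinuousMap Plane ℝ) y, ‖φ y‖ ≤ ‖φ‖ := fun φ y => by
    rw [← ZeroAtInftyContinuousMap.norm_toBCF_eq_norm]
    exact φ.toBCF.norm_coe_le_norm y
  have hint : ∀ (φ : ZeroAtInftyContinuousMap Plane ℝ) t, Integrable φ (μ t) := fun φ t =>
    Integrable.of_bound (map_continuous φ).aestronglyMeasurable ‖φ‖ (ae_of_all _ (hle φ))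
  let g : Icc a b → ZeroAtInftyContinuousMap Plane ℝ →L[ℝ] ℝ := fun t =>
    LinearMap.mkContinuous
      { toFun := fun φ => ∫ y, φ y ∂(μ t)
        map_add' := fun φ ψ => integral_add (hint φ t) (hint ψ t)
        map_smul' := fun c φ => integral_const_mul c _ } ((μ t).real univ) fun φ => by
      have := norm_integral_le_of_norm_le_const (μ := μ t) (ae_of_all _ (hle φ))
      rwa [mul_comm] at this
  obtain ⟨M, hM⟩ := banach_steinhaus (g := g) fun φ => by
    obtain ⟨C, hC⟩ := isCompact_Icc.exists_bound_of_continuousOn (hcont φ).continuousOn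
    exact ⟨C, fun t => hC t t.2⟩
  refine ⟨max M 0, le_max_right _ _, fun t ht => ?_⟩
  have hlim : Filter.Tendsto
      (fun n : ℕ => ∫ y, Real.smoothTransition ((n : ℝ) - ‖y‖ ^ 2) ∂(μ t)) Filter.atTop
      (𝓝 (∫ _, (1 : ℝ) ∂(μ t))) :=
    tendsto_integral_of_dominated_convergence (fun _ => 1)
      (fun n => (contDiff_smoothTransition_sub_normSq n).continuous.aestronglyMeasurable)
      (integrable_const _)
      (fun n => ae_of_all _ fun y => by
        rw [Real.norm_of_nonneg (Real.smoothTransition.nonneg _)]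
        exact Real.smoothTransition.le_one _)
      (ae_of_all _ tendsto_smoothTransition_sub_normSq)
  rw [integral_const, smul_eq_mul, mul_one] at hlim
  refine le_of_tendsto' hlim fun n => ?_
  let φ : ZeroAtInftyContinuousMap Plane ℝ :=
    ⟨⟨_, (contDiff_smoothTransition_sub_normSq n).continuous⟩,
      (hasCompactSupport_smoothTransition_sub_normSq n).is_zero_at_infty⟩
  have hφ : ‖φ‖ ≤ 1 := by
    rw [← ZeroAtInftyContinuousMap.norm_toBCF_eq_norm,
      BoundedContinuousFunction.norm_le zero_le_one]
    intro y
    change ‖Real.smoothTransition ((n : ℝ) - ‖y‖ ^ 2)‖ ≤ 1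
    rw [Real.norm_of_nonneg (Real.smoothTransition.nonneg _)]
    exact Real.smoothTransition.le_one _
  calc ∫ y, Real.smoothTransition ((n : ℝ) - ‖y‖ ^ 2) ∂(μ t) = g ⟨t, ht⟩ φ := rfl
    _ ≤ ‖g ⟨t, ht⟩ φ‖ := le_abs_self _
    _ ≤ ‖g ⟨t, ht⟩‖ * ‖φ‖ := (g ⟨t, ht⟩).le_opNorm φ
    _ ≤ max M 0 * 1 := by
        gcongr
        exact (hM _).trans (le_max_left _ _)
    _ = max M 0 := mul_one _

/-- Integrals of a continuous family of functions with supports in a fixed compact set depend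
continuously on the parameter. -/
theorem continuousAt_integral_of_weakStar
    (hcont : ∀ φ : ZeroAtInftyContinuousMap Plane ℝ, Continuous fun t => ∫ y, φ y ∂(μ t))
    {P : Type*} [TopologicalSpace P] {τ : P → ℝ} {p₀ : P} (hτ : ContinuousAt τ p₀)
    {f : P → Plane → ℝ} (hf : Continuous fun z : P × Plane => f z.1 z.2) {K : Set Plane}
    (hK : IsCompact K) (hsupp : ∀ᶠ p in 𝓝 p₀, ∀ y ∉ K, f p y = 0) :
    ContinuousAt (fun p => ∫ y, f p y ∂(μ (τ p))) p₀ := by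
  have hfc : ∀ p, Continuous (f p) := fun p => hf.comp (by fun_prop : Continuous fun y => (p, y))
  have hfi : ∀ p, (∀ y ∉ K, f p y = 0) → ∀ t, Integrable (f p) (μ t) := fun p hp t =>
    (hfc p).integrable_of_hasCompactSupport (HasCompactSupport.intro hK hp)
  have h0 := hsupp.self_of_nhds
  obtain ⟨M, hM0, hM⟩ := exists_measureReal_univ_le hcont (τ p₀ - 1) (τ p₀ + 1)
  let φ : ZeroAtInftyContinuousMap Plane ℝ :=
    ⟨⟨f p₀, hfc p₀⟩, (HasCompactSupport.intro hK h0).is_zero_at_infty⟩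
  have h1 : Filter.Tendsto (fun p => ∫ y, f p₀ y ∂(μ (τ p))) (𝓝 p₀)
      (𝓝 (∫ y, f p₀ y ∂(μ (τ p₀)))) :=
    ((hcont φ).tendsto (τ p₀)).comp hτ
  rw [ContinuousAt, Metric.tendsto_nhds]
  intro ε hε
  have h2 : ∀ᶠ p in 𝓝 p₀, ∀ y ∈ K, |f p y - f p₀ y| < ε / (2 * (M + 1)) := by
    refine hK.eventually_forall_of_forall_eventually fun y _ => ?_
    have hc : Continuous fun z : P × Plane => |f z.1 z.2 - f p₀ z.2| :=
      (hf.sub ((hfc p₀).comp continuous_snd)).abs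
    refine hc.tendsto (p₀, y) |>.eventually_lt_const ?_
    simpa using by positivity
  have h3 : ∀ᶠ p in 𝓝 p₀, τ p ∈ Icc (τ p₀ - 1) (τ p₀ + 1) :=
    hτ (Icc_mem_nhds (by linarith) (by linarith))
  filter_upwards [h2, h3, hsupp, Metric.tendsto_nhds.1 h1 (ε / 2) (half_pos hε)]
    with p hp2 hp3 hp4 hp1
  have h5 : ‖∫ y, (f p y - f p₀ y) ∂(μ (τ p))‖ ≤ ε / (2 * (M + 1)) * (μ (τ p)).real univ := by
    refine norm_integral_le_of_norm_le_const (ae_of_all _ fun y => ?_)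
    by_cases hy : y ∈ K
    · exact (hp2 y hy).le
    · rw [hp4 y hy, h0 y hy, sub_zero, norm_zero]
      positivity
  rw [integral_sub (hfi p hp4 _) (hfi p₀ h0 _)] at h5
  have h6 : ε / (2 * (M + 1)) * (μ (τ p)).real univ ≤ ε / 2 := by
    calc _ ≤ ε / (2 * (M + 1)) * (M + 1) := by
          gcongr
          linarith [hM _ hp3]
      _ = ε / 2 := by field_simp
  calc dist (∫ y, f p y ∂(μ (τ p))) (∫ y, f p₀ y ∂(μ (τ p₀)))
      ≤ dist (∫ y, f p y ∂(μ (τ p))) (∫ y, f p₀ y ∂(μ (τ p)))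
        + dist (∫ y, f p₀ y ∂(μ (τ p))) (∫ y, f p₀ y ∂(μ (τ p₀))) := dist_triangle _ _ _
    _ < ε / 2 + ε / 2 := add_lt_add_of_le_of_lt ((dist_eq_norm _ _).trans_le (h5.trans h6)) hp1
    _ = ε := add_halves ε

end

/-! ### The weak formulation at a fixed time -/

/-- A continuous function on the line whose distributional derivative vanishes is constant. -/
lemma eq_of_integral_deriv_mul_eq_zero {H : ℝ → ℝ} (hH : Continuous H)
    (h : ∀ χ : ℝ → ℝ, ContDiff ℝ ∞ χ → HasCompactSupport χ → ∫ t, deriv χ t * H t = 0)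
    (a b : ℝ) : H a = H b := by
  let φ : ℕ → ContDiffBump (0 : ℝ) := fun n =>
    ⟨1 / ((n : ℝ) + 1) / 2, 1 / ((n : ℝ) + 1), by positivity, half_lt_self (by positivity)⟩
  have hφ : Filter.Tendsto (fun n => (φ n).rOut) Filter.atTop (𝓝 0) :=
    tendsto_one_div_add_atTop_nhds_zero_nat
  have hlim := fun x => ContDiffBump.convolution_tendsto_right_of_continuous (μ := volume)
    hφ hH x
  have hconst : ∀ n x, HasDerivAt (MeasureTheory.convolution ((φ n).normed volume) H
      (ContinuousLinearMap.lsmul ℝ ℝ) volume) 0 x := by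
    intro n x
    have hs : ContDiff ℝ ∞ ((φ n).normed volume) := (φ n).contDiff_normed
    have hc : HasCompactSupport ((φ n).normed volume) := (φ n).hasCompactSupport_normed
    have hd := hc.hasDerivAt_convolution_left (ContinuousLinearMap.lsmul ℝ ℝ)
      (hs.of_le (by exact_mod_cast le_top)) (hH.locallyIntegrable (μ := volume)) x
    refine hd.congr_deriv ?_
    rw [convolution_eq_swap]
    have h1 := h (fun s => (φ n).normed volume (x - s))
      (hs.comp (contDiff_const.sub contDiff_id)) (hc.comp_homeomorph (Homeomorph.subLeft x))
    simp_rw [deriv_comp_const_sub, neg_mul, integral_neg, neg_eq_zero] at h1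
    simpa using h1
  have heq : ∀ n, MeasureTheory.convolution ((φ n).normed volume) H
      (ContinuousLinearMap.lsmul ℝ ℝ) volume a = MeasureTheory.convolution ((φ n).normed volume) H
      (ContinuousLinearMap.lsmul ℝ ℝ) volume b := fun n =>
    is_const_of_deriv_eq_zero (fun x => (hconst n x).differentiableAt)
      (fun x => (hconst n x).deriv) a b
  exact tendsto_nhds_unique (hlim a) ((hlim b).congr fun n => (heq n).symm)

/-- The lemma of du Bois-Reymond. -/
lemma hasDerivAt_of_integral_deriv_mul_add {F G : ℝ → ℝ} (hF : Continuous F) (hG : Continuous G)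
    (h : ∀ χ : ℝ → ℝ, ContDiff ℝ ∞ χ → HasCompactSupport χ →
      ∫ t, (deriv χ t * F t + χ t * G t) = 0) (t : ℝ) : HasDerivAt F (G t) t := by
  let P : ℝ → ℝ := fun t => ∫ s in (0 : ℝ)..t, G s
  have hP : ∀ t, HasDerivAt P (G t) t := fun t => hG.integral_hasStrictDerivAt 0 t |>.hasDerivAt
  have hPc : Continuous P := continuous_iff_continuousAt.2 fun t => (hP t).continuousAt
  have hconst := eq_of_integral_deriv_mul_eq_zero (hF.sub hPc) fun χ hχ hχc => by
    have hd : Continuous (deriv χ) := hχ.continuous_deriv (by exact_mod_cast le_top)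
    have hi : ∀ {g : ℝ → ℝ}, Continuous g → Integrable (fun t => χ t * g t) := fun hg =>
      (hχ.continuous.mul hg).integrable_of_hasCompactSupport hχc.mul_right
    have hi' : ∀ {g : ℝ → ℝ}, Continuous g → Integrable (fun t => deriv χ t * g t) := fun hg =>
      (hd.mul hg).integrable_of_hasCompactSupport hχc.deriv.mul_right
    have h1 := h χ hχ hχc
    rw [integral_add (hi' hF) (hi hG)] at h1
    have h2 := integral_mul_deriv_eq_deriv_mul_of_integrable (u := χ) (v := P)
      (fun t _ => (hχ.differentiable (by simp) t).hasDerivAt) (fun t _ => hP t) (hi hG) (hi' hPc)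
      (hi hPc)
    simp_rw [Pi.sub_apply, mul_sub]
    rw [integral_sub (hi' hF) (hi' hPc)]
    linarith
  have h3 : F = fun s => P s + (F t - P t) := by
    ext s
    have := hconst s t
    simp only [Pi.sub_apply] at this
    linarith
  rw [h3]
  exact (hP t).add_const _

/-- The transport equation tested with a function of space alone: the pairing of `φ` with the
vorticity is continuously differentiable in time. -/
theorem hasDerivAt_integral_of_transport {μ : ℝ → Measure Plane} [∀ t, IsFiniteMeasure (μ t)]
    {u : ℝ → C(Plane, Plane)} (hu : Continuous u)
    (hcont : ∀ φ : ZeroAtInftyContinuousMap Plane ℝ, Continuous fun t => ∫ y, φ y ∂(μ t))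
    (htr : ∀ ψ : ℝ × Plane → ℝ, ContDiff ℝ ∞ ψ → HasCompactSupport ψ →
      ∫ t : ℝ, (∫ y, fderiv ℝ ψ (t, y) (1, u t y) ∂(μ t)) = 0)
    {φ : Plane → ℝ} (hφ : ContDiff ℝ ∞ φ) (hφc : HasCompactSupport φ) (t : ℝ) :
    HasDerivAt (fun t => ∫ y, φ y ∂(μ t)) (∫ y, fderiv ℝ φ y (u t y) ∂(μ t)) t := by
  have hu' : Continuous fun z : ℝ × Plane => u z.1 z.2 := by fun_prop
  have hdφ : Continuous (fderiv ℝ φ) := hφ.continuous_fderiv (by simp)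
  have hF : Continuous fun t => ∫ y, φ y ∂(μ t) :=
    hcont ⟨⟨φ, hφ.continuous⟩, hφc.is_zero_at_infty⟩
  have hG : Continuous fun t => ∫ y, fderiv ℝ φ y (u t y) ∂(μ t) := by
    refine continuous_iff_continuousAt.2 fun t => ?_
    refine continuousAt_integral_of_weakStar hcont (τ := id) continuousAt_id
      (f := fun t y => fderiv ℝ φ y (u t y)) ?_ hφc (Filter.Eventually.of_forall fun p y hy => ?_)
    · exact (hdφ.comp continuous_snd).clm_apply hu'
    · have : fderiv ℝ φ y = 0 := fderiv_of_notMem_tsupport ℝ hy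
      simp [this]
  refine hasDerivAt_of_integral_deriv_mul_add hF hG (fun χ hχ hχc => ?_) t
  have hψc : HasCompactSupport fun z : ℝ × Plane => χ z.1 * φ z.2 := by
    refine HasCompactSupport.intro (hχc.prod hφc) fun z hz => ?_
    by_contra hne
    exact hz ⟨subset_tsupport _ (left_ne_zero_of_mul hne),
      subset_tsupport _ (right_ne_zero_of_mul hne)⟩
  rw [← htr (fun z => χ z.1 * φ z.2)
    ((hχ.comp contDiff_fst).mul (hφ.comp contDiff_snd)) hψc]
  congr 1 with t
  have hd : ∀ y, fderiv ℝ (fun z : ℝ × Plane => χ z.1 * φ z.2) (t, y) (1, u t y)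
      = deriv χ t * φ y + χ t * fderiv ℝ φ y (u t y) := fun y => by
    have h1 : HasFDerivAt (fun z : ℝ × Plane => χ z.1) _ (t, y) :=
      ((hχ.differentiable (by simp) t).hasDerivAt.hasFDerivAt).comp (t, y) hasFDerivAt_fst
    have h2 : HasFDerivAt (fun z : ℝ × Plane => φ z.2) _ (t, y) :=
      ((hφ.differentiable (by simp) y).hasFDerivAt).comp (t, y) hasFDerivAt_snd
    have h3 : HasFDerivAt (fun z : ℝ × Plane => χ z.1 * φ z.2) _ (t, y) := h1.mul h2
    rw [h3.fderiv]
    simp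
    ring
  simp_rw [hd]
  have hi1 : Integrable φ (μ t) := hφ.continuous.integrable_of_hasCompactSupport hφc
  have hi2 : Integrable (fun y => fderiv ℝ φ y (u t y)) (μ t) := by
    refine (hdφ.clm_apply (u t).continuous).integrable_of_hasCompactSupport
      (HasCompactSupport.intro hφc fun y hy => ?_)
    have : fderiv ℝ φ y = 0 := fderiv_of_notMem_tsupport ℝ hy
    simp [this]
  rw [integral_add (hi1.const_mul _) (hi2.const_mul _), integral_const_mul, integral_const_mul]

/-! ### Log-Lipschitz flows -/

/-- `β` is the flow, started at time `t₀`, of the velocity field `u`; it preserves the Lebesgue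
measure. For `|t - t₀| ≤ r` the field `u` is bounded by `B` and log-Lipschitz with constant `L`. The
log-Lipschitz bound is stated with a free parameter `S`; the choice `exp (-S) = ‖y - z‖` gives the
usual form. -/
structure IsLogLipschitzFlow (u : ℝ → Plane → Plane) (β : ℝ → Plane ≃ₜ Plane)
    (t₀ r B L : ℝ) : Prop where
  radius_pos : 0 < r
  const_pos : 0 < L
  continuous_velocity : Continuous fun z : ℝ × Plane => u z.1 z.2
  measurePreserving : ∀ t, MeasurePreserving (β t) volume volume
  base : ∀ y, β t₀ y = y
  hasDerivAt : ∀ y t, HasDerivAt (fun s => β s y) (u t (β t y)) t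
  norm_le : ∀ t ∈ Icc (t₀ - r) (t₀ + r), ∀ y, ‖u t y‖ ≤ B
  norm_sub_le : ∀ t ∈ Icc (t₀ - r) (t₀ + r), ∀ S, 0 ≤ S → ∀ y z,
    ‖u t y - u t z‖ ≤ L * (S * ‖y - z‖ + Real.exp (-S))

namespace IsLogLipschitzFlow

variable {u : ℝ → Plane → Plane} {β : ℝ → Plane ≃ₜ Plane} {t₀ r B L : ℝ}

lemma bound_nonneg (h : IsLogLipschitzFlow u β t₀ r B L) : 0 ≤ B :=
  (norm_nonneg _).trans
    (h.norm_le t₀ ⟨by linarith [h.radius_pos], by linarith [h.radius_pos]⟩ 0)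

/-- Particles move at most by `B |t - t₀|`. -/
lemma norm_flow_sub_le (h : IsLogLipschitzFlow u β t₀ r B L) {t : ℝ}
    (ht : t ∈ Icc (t₀ - r) (t₀ + r)) (y : Plane) : ‖β t y - y‖ ≤ B * |t - t₀| := by
  have hr := h.radius_pos
  have := (convex_Icc (t₀ - r) (t₀ + r)).norm_image_sub_le_of_norm_hasDerivWithin_le
    (f := fun s => β s y) (fun s _ => (h.hasDerivAt y s).hasDerivWithinAt)
    (fun s hs => h.norm_le s hs _) (x := t₀) ⟨by linarith, by linarith⟩ ht
  simpa [h.base] using this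

/-- Gronwall's inequality for the distance of two trajectories, traced back from time `t` to
time `t₀`. -/
theorem norm_sub_le_exp (h : IsLogLipschitzFlow u β t₀ r B L) {t : ℝ}
    (ht : t ∈ Icc (t₀ - r) (t₀ + r)) {S : ℝ} (hS : 1 ≤ S) (a b : Plane) :
    ‖a - b‖ ≤ (‖β t a - β t b‖ + Real.exp (-S)) * Real.exp (L * S * |t - t₀|) := by
  have hK : 0 < L * S := mul_pos h.const_pos (by linarith)
  -- the direction of time that leads from `t` to `t₀`
  obtain ⟨c, hc, htc⟩ : ∃ c : ℝ, |c| = 1 ∧ t + c * |t - t₀| = t₀ := by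
    rcases le_total t t₀ with h1 | h1
    · exact ⟨1, by simp, by rw [abs_of_nonpos (by linarith)]; ring⟩
    · exact ⟨-1, by simp, by rw [abs_of_nonneg (by linarith)]; ring⟩
  let f : ℝ → Plane := fun s => β (t + c * s) a - β (t + c * s) b
  let f' : ℝ → Plane := fun s =>
    c • (u (t + c * s) (β (t + c * s) a) - u (t + c * s) (β (t + c * s) b))
  have hf : ∀ s, HasDerivAt f (f' s) s := fun s => by
    have h1 : HasDerivAt (fun s : ℝ => t + c * s) c s := by
      simpa using ((hasDerivAt_id s).const_mul c).const_add t
    exact (((h.hasDerivAt a _).sub (h.hasDerivAt b _)).scomp s h1)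
  have hmem : ∀ s ∈ Ico 0 |t - t₀|, t + c * s ∈ Icc (t₀ - r) (t₀ + r) := by
    intro s hs
    have h1 : |t - t₀| ≤ r := abs_le.2 ⟨by linarith [ht.1], by linarith [ht.2]⟩
    have h2 : t + c * s - t₀ = c * (s - |t - t₀|) := by linear_combination htc
    have h3 : |t + c * s - t₀| ≤ r := by
      rw [h2, abs_mul, hc, one_mul, abs_of_nonpos (by linarith [hs.2])]
      linarith [hs.1]
    obtain ⟨h4, h5⟩ := abs_le.1 h3
    exact ⟨by linarith, by linarith⟩
  have hg := norm_le_gronwallBound_of_norm_deriv_right_le (f := f) (f' := f') (K := L * S)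
    (ε := L * S * Real.exp (-S)) (δ := ‖β t a - β t b‖) (a := 0) (b := |t - t₀|)
    (fun s _ => (hf s).continuousAt.continuousWithinAt) (fun s _ => (hf s).hasDerivWithinAt)
    (by simp [f]) (fun s hs => by
      rw [norm_smul, Real.norm_eq_abs, hc, one_mul]
      refine (h.norm_sub_le _ (hmem s hs) S (by linarith) _ _).trans ?_
      have h1 : Real.exp (-S) ≤ S * Real.exp (-S) :=
        le_mul_of_one_le_left (Real.exp_nonneg _) hS
      have h2 := mul_le_mul_of_nonneg_left h1 h.const_pos.le
      calc _ = L * S * ‖f s‖ + L * Real.exp (-S) := by ring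
        _ ≤ _ := by linarith) |t - t₀| (right_mem_Icc.2 (abs_nonneg _))
  rw [gronwallBound_of_K_ne_0 hK.ne', sub_zero, mul_div_assoc] at hg
  have hend : f |t - t₀| = a - b := by simp only [f]; rw [htc, h.base, h.base]
  rw [hend] at hg
  have h3 : L * S * (Real.exp (-S) / (L * S)) = Real.exp (-S) :=
    mul_div_cancel₀ _ hK.ne'
  rw [h3] at hg
  have := Real.exp_nonneg (-S)
  linarith

lemma continuous_velocity_at (h : IsLogLipschitzFlow u β t₀ r B L) (t : ℝ) :
    Continuous (u t) := h.continuous_velocity.comp (by fun_prop : Continuous fun y => (t, y))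

/-- The change of variables `z = y - β_t(w)`. -/
lemma integral_comp_sub_flow (h : IsLogLipschitzFlow u β t₀ r B L) {E : Type*}
    [NormedAddCommGroup E] [NormedSpace ℝ E] (k : Plane → E) (t : ℝ) (y : Plane) :
    ∫ w, k (y - β t w) = ∫ z, k z := by
  rw [(h.measurePreserving t).integral_comp (β t).measurableEmbedding (fun z => k (y - z))]
  exact integral_sub_left_eq_self k volume y

/-- If `G(w, y)` has mass `κ` in `w` and is concentrated on `|y - β_t(w)| ≤ exp (-S)`, then its
integral against `φ(w)` is close to the integral of `κ φ ∘ β_t⁻¹`. -/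
theorem abs_integral_integral_sub_le (h : IsLogLipschitzFlow u β t₀ r B L) {t : ℝ}
    (ht : t ∈ Icc (t₀ - r) (t₀ + r)) {S : ℝ} (hS : 1 ≤ S) {ν : Measure Plane} [IsFiniteMeasure ν]
    {φ : Plane → ℝ} (hφ : Continuous φ) (hφc : HasCompactSupport φ) {Λ : ℝ} (hΛ : 0 ≤ Λ)
    (hφΛ : ∀ a b, |φ a - φ b| ≤ Λ * ‖a - b‖) {G : Plane → Plane → ℝ}
    (hG : Continuous (Function.uncurry G)) {k : Plane → ℝ} (hk : Continuous k)
    (hk0 : ∀ z, Real.exp (-S) < ‖z‖ → k z = 0) (hGk : ∀ w y, |G w y| ≤ k (y - β t w)) {κ : ℝ}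
    (hκ : ∀ y, ∫ w, G w y = κ) :
    |(∫ w, φ w * ∫ y, G w y ∂ν) - κ * ∫ y, φ ((β t).symm y) ∂ν| ≤
      Λ * (2 * Real.exp (-S) * Real.exp (L * S * |t - t₀|)) * (∫ z, k z) * ν.real univ := by
  have hkc : HasCompactSupport k := HasCompactSupport.intro
    (isCompact_closedBall (0 : Plane) (Real.exp (-S))) fun z hz => hk0 z (by simpa using hz)
  obtain ⟨Ck, hCk⟩ := hkc.exists_bound_of_continuous hk
  obtain ⟨Cφ, hCφ⟩ := hφc.exists_bound_of_continuous hφ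
  have hφi : Integrable φ := hφ.integrable_of_hasCompactSupport hφc
  have hGC : ∀ w y, |G w y| ≤ Ck := fun w y => (hGk w y).trans ((le_abs_self _).trans (hCk _))
  have hprod : Integrable (Function.uncurry fun w y => φ w * G w y) (volume.prod ν) := by
    refine ((hφi.norm.mul_const Ck).comp_fst ν).mono' ?_ (ae_of_all _ fun z => ?_)
    · exact ((hφ.comp continuous_fst).mul hG).aestronglyMeasurable
    · simp only [Function.uncurry, norm_mul, Real.norm_eq_abs]
      exact mul_le_mul_of_nonneg_left (hGC _ _) (abs_nonneg _)
  have hsupp : ∀ y, HasCompactSupport fun w => k (y - β t w) := fun y =>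
    (hkc.comp_homeomorph (Homeomorph.subLeft y)).comp_homeomorph (β t)
  have hki : ∀ y, Integrable fun w => k (y - β t w) := fun y =>
    (hk.comp (continuous_const.sub (β t).continuous)).integrable_of_hasCompactSupport (hsupp y)
  have hGy : ∀ y, Continuous fun w => G w y := fun y =>
    hG.comp (by fun_prop : Continuous fun w => (w, y))
  have hGi : ∀ y, Integrable fun w => G w y := fun y =>
    (hki y).mono' (hGy y).aestronglyMeasurable (ae_of_all _ fun w => hGk w y)
  have hφGi : ∀ y, Integrable fun w => φ w * G w y := fun y =>
    (hGi y).bdd_mul (c := Cφ) hφ.aestronglyMeasurable (ae_of_all _ hCφ)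
  have hinner : ∀ y, ‖(∫ w, φ w * G w y) - κ * φ ((β t).symm y)‖ ≤
      Λ * (2 * Real.exp (-S) * Real.exp (L * S * |t - t₀|)) * ∫ z, k z := by
    intro y
    have h1 : (∫ w, φ w * G w y) - κ * φ ((β t).symm y)
        = ∫ w, (φ w - φ ((β t).symm y)) * G w y := by
      simp_rw [sub_mul]
      rw [integral_sub (hφGi y) ((hGi y).const_mul _), integral_const_mul, hκ, mul_comm κ]
    rw [h1, ← h.integral_comp_sub_flow k t y, ← integral_const_mul]
    refine norm_integral_le_of_norm_le ((hki y).const_mul _) (ae_of_all _ fun w => ?_)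
    rw [norm_mul, Real.norm_eq_abs, Real.norm_eq_abs]
    by_cases hw : Real.exp (-S) < ‖y - β t w‖
    · have h2 := hGk w y
      rw [hk0 _ hw] at h2 ⊢
      rw [abs_nonpos_iff.1 h2]
      simp
    · have h2 := h.norm_sub_le_exp ht hS w ((β t).symm y)
      rw [Homeomorph.apply_symm_apply, norm_sub_rev (β t w)] at h2
      have h3 : ‖w - (β t).symm y‖ ≤ 2 * Real.exp (-S) * Real.exp (L * S * |t - t₀|) := by
        refine h2.trans ?_
        gcongr
        linarith [not_lt.1 hw]
      have hk1 : 0 ≤ k (y - β t w) := (abs_nonneg _).trans (hGk w y)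
      exact mul_le_mul ((hφΛ _ _).trans (mul_le_mul_of_nonneg_left h3 hΛ)) (hGk w y)
        (abs_nonneg _) (by positivity)
  have hswap : ∫ w, φ w * ∫ y, G w y ∂ν = ∫ y, (∫ w, φ w * G w y) ∂ν := by
    simp_rw [← integral_const_mul]
    exact integral_integral_swap hprod
  have hi2 : Integrable (fun y => κ * φ ((β t).symm y)) ν :=
    ((hφ.comp (β t).symm.continuous).integrable_of_hasCompactSupport
      (hφc.comp_homeomorph (β t).symm)).const_mul κ
  have hi1 : Integrable (fun y => ∫ w, φ w * G w y) ν := hprod.integral_prod_right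
  rw [hswap, ← integral_const_mul, ← integral_sub hi1 hi2]
  exact norm_integral_le_of_norm_le_const (ae_of_all _ hinner)

end IsLogLipschitzFlow

/-! ### Mollifiers -/

/-- `ρ` is a nonnegative smooth function of integral `1` with support in the ball of radius `ε`, and
its gradient has `L¹` norm at most `C / ε`. -/
structure IsMollifier (ρ : Plane → ℝ) (ε C : ℝ) : Prop where
  contDiff : ContDiff ℝ ∞ ρ
  tsupport_subset : tsupport ρ ⊆ Metric.closedBall 0 ε
  nonneg : ∀ z, 0 ≤ ρ z
  integral_eq_one : ∫ z, ρ z = 1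
  integral_norm_fderiv_le : ∫ z, ‖fderiv ℝ ρ z‖ ≤ C / ε

lemma exists_isMollifier : ∃ C : ℝ, 0 ≤ C ∧ ∀ ε : ℝ, 0 < ε → ∃ ρ : Plane → ℝ,
    IsMollifier ρ ε C := by
  obtain ⟨ρ, hρ, hsupp, hnn, hone⟩ : ∃ ρ : Plane → ℝ, ContDiff ℝ ∞ ρ ∧
      (∀ z, ρ z ≠ 0 → ‖z‖ < 1) ∧ (∀ z, 0 ≤ ρ z) ∧ ∫ z, ρ z = 1 := by
    let b : ContDiffBump (0 : Plane) := ⟨1 / 2, 1, by norm_num, by norm_num⟩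
    refine ⟨b.normed volume, b.contDiff_normed, fun z hz => ?_, b.nonneg_normed,
      b.integral_normed⟩
    have h1 : z ∈ Function.support (b.normed volume) := hz
    rw [b.support_normed_eq] at h1
    simpa [b] using h1
  refine ⟨∫ z, ‖fderiv ℝ ρ z‖, integral_nonneg fun _ => norm_nonneg _, fun ε hε =>
    ⟨fun z => (ε ^ 2)⁻¹ * ρ (ε⁻¹ • z), ?_, ?_, ?_, ?_, ?_⟩⟩
  · exact contDiff_const.mul (hρ.comp (contDiff_const_smul _))
  · refine closure_minimal (fun z hz => ?_) Metric.isClosed_closedBall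
    have h1 := hsupp _ (right_ne_zero_of_mul hz)
    rw [norm_smul, norm_inv, Real.norm_of_nonneg hε.le] at h1
    rw [mem_closedBall_zero_iff]
    exact ((inv_mul_lt_one₀ hε).1 h1).le
  · exact fun z => mul_nonneg (by positivity) (hnn _)
  · rw [integral_const_mul, Measure.integral_comp_inv_smul volume ρ ε, hone]
    simp
    field_simp
  · have h1 : ∀ z, ‖fderiv ℝ (fun z => (ε ^ 2)⁻¹ * ρ (ε⁻¹ • z)) z‖
        = (ε ^ 2)⁻¹ * ε⁻¹ * ‖fderiv ℝ ρ (ε⁻¹ • z)‖ := fun z => by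
      have h2 : HasFDerivAt (fun z => ρ (ε⁻¹ • z))
          ((fderiv ℝ ρ (ε⁻¹ • z)).comp (ε⁻¹ • ContinuousLinearMap.id ℝ Plane)) z :=
        (hρ.differentiable (by simp) (ε⁻¹ • z)).hasFDerivAt.comp z
          ((hasFDerivAt_id z).const_smul ε⁻¹)
      rw [(h2.const_mul ((ε ^ 2)⁻¹)).fderiv, ContinuousLinearMap.comp_smul,
        ContinuousLinearMap.comp_id, norm_smul, norm_smul, norm_inv, norm_inv, norm_pow,
        Real.norm_of_nonneg hε.le, mul_assoc]
    simp_rw [h1]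
    rw [integral_const_mul,
      Measure.integral_comp_inv_smul volume (fun z => ‖fderiv ℝ ρ z‖) ε]
    simp only [finrank_euclideanSpace, Fintype.card_fin, abs_pow, abs_of_pos hε, smul_eq_mul]
    apply le_of_eq
    field_simp

namespace IsMollifier

variable {ρ : Plane → ℝ} {ε C : ℝ}

lemma hasCompactSupport (h : IsMollifier ρ ε C) : HasCompactSupport ρ :=
  (isCompact_closedBall 0 ε).of_isClosed_subset (isClosed_tsupport ρ) h.tsupport_subset

lemma eq_zero (h : IsMollifier ρ ε C) {z : Plane} (hz : ε < ‖z‖) : ρ z = 0 :=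
  image_eq_zero_of_notMem_tsupport fun h1 => by
    have := h.tsupport_subset h1
    rw [mem_closedBall_zero_iff] at this
    linarith

lemma fderiv_eq_zero (h : IsMollifier ρ ε C) {z : Plane} (hz : ε < ‖z‖) : fderiv ℝ ρ z = 0 :=
  fderiv_of_notMem_tsupport ℝ fun h1 => by
    have := h.tsupport_subset h1
    rw [mem_closedBall_zero_iff] at this
    linarith

lemma differentiable (h : IsMollifier ρ ε C) : Differentiable ℝ ρ :=
  h.contDiff.differentiable (by simp)

lemma continuous_fderiv (h : IsMollifier ρ ε C) : Continuous (fderiv ℝ ρ) :=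
  h.contDiff.continuous_fderiv (by simp)

lemma exists_norm_fderiv_le (h : IsMollifier ρ ε C) : ∃ D, ∀ z, ‖fderiv ℝ ρ z‖ ≤ D :=
  (h.hasCompactSupport.fderiv (𝕜 := ℝ)).exists_bound_of_continuous h.continuous_fderiv

lemma integral_fderiv_apply (h : IsMollifier ρ ε C) (v : Plane) : ∫ z, fderiv ℝ ρ z v = 0 := by
  have hi : Integrable fun z => fderiv ℝ ρ z v :=
    (h.continuous_fderiv.clm_apply continuous_const).integrable_of_hasCompactSupport
      (HasCompactSupport.intro (isCompact_closedBall 0 ε) fun z hz => by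
        rw [h.fderiv_eq_zero (by simpa using hz)]; rfl)
  have := integral_mul_fderiv_eq_neg_fderiv_mul_of_integrable (μ := volume) (𝕜 := ℝ)
    (f := ρ) (g := fun _ => 1) (v := v) (by simpa using hi) (by simp)
    (by simpa using h.contDiff.continuous.integrable_of_hasCompactSupport h.hasCompactSupport)
    (fun z _ => h.differentiable z) (fun z _ => differentiableAt_const _)
  simpa using this

end IsMollifier

/-! ### Transport of the measure along the flow -/

/-- The commutator of transport and mollification. -/
noncomputable def commutatorKernel (u : ℝ → Plane → Plane) (β : ℝ → Plane ≃ₜ Plane)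
    (ρ : Plane → ℝ) (t : ℝ) (w y : Plane) : ℝ :=
  fderiv ℝ ρ (y - β t w) (u t y - u t (β t w))

section
variable {u : ℝ → Plane → Plane} {β : ℝ → Plane ≃ₜ Plane} {t₀ r B L : ℝ} {ρ : Plane → ℝ}
  {ε C : ℝ}

lemma IsLogLipschitzFlow.continuous_commutatorKernel (h : IsLogLipschitzFlow u β t₀ r B L)
    (hρ : IsMollifier ρ ε C) (t : ℝ) :
    Continuous (Function.uncurry (commutatorKernel u β ρ t)) := by
  have hu := h.continuous_velocity_at t
  have hβ := (β t).continuous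
  have hd := hρ.continuous_fderiv
  unfold commutatorKernel Function.uncurry
  exact (hd.comp (continuous_snd.sub (hβ.comp continuous_fst))).clm_apply
    ((hu.comp continuous_snd).sub (hu.comp (hβ.comp continuous_fst)))

/-- Preservation of the Lebesgue measure makes the velocity weakly divergence free, whence the
commutator kernel has mean zero in `w`. -/
theorem IsLogLipschitzFlow.integral_commutatorKernel (h : IsLogLipschitzFlow u β t₀ r B L)
    (hρ : IsMollifier ρ ε C) {t : ℝ} (ht : t ∈ Ioo (t₀ - r) (t₀ + r)) (y : Plane) :
    ∫ w, commutatorKernel u β ρ t w y = 0 := by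
  obtain ⟨D, hD⟩ := hρ.exists_norm_fderiv_le
  have hB := h.bound_nonneg
  have hD0 : 0 ≤ D := (norm_nonneg _).trans (hD 0)
  have hd := hρ.continuous_fderiv
  have hJ : Ioo (t₀ - r) (t₀ + r) ∈ 𝓝 t := isOpen_Ioo.mem_nhds ht
  have hKc : IsCompact (Metric.closedBall y (ε + B * r)) := isCompact_closedBall _ _
  -- particles outside this ball stay outside the support of the mollifier
  have hfar : ∀ s ∈ Ioo (t₀ - r) (t₀ + r), ∀ w ∉ Metric.closedBall y (ε + B * r),
      ε < ‖y - β s w‖ := by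
    intro s hs w hw
    rw [Metric.mem_closedBall, not_le, dist_eq_norm] at hw
    have h1 := h.norm_flow_sub_le (Ioo_subset_Icc_self hs) w
    have h2 : |s - t₀| ≤ r := abs_le.2 ⟨by linarith [hs.1], by linarith [hs.2]⟩
    have h3 : B * |s - t₀| ≤ B * r := by gcongr
    have h4 : ‖w - y‖ ≤ ‖y - β s w‖ + ‖β s w - w‖ := by
      have := norm_add_le (y - β s w) (β s w - w)
      rwa [sub_add_sub_cancel, norm_sub_rev y w] at this
    linarith
  have hcont : ∀ s, Continuous fun w => ρ (y - β s w) := fun s =>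
    hρ.contDiff.continuous.comp (continuous_const.sub (β s).continuous)
  have hcont' : ∀ s, Continuous fun w => fderiv ℝ ρ (y - β s w) (-u s (β s w)) := fun s =>
    (hd.comp (continuous_const.sub (β s).continuous)).clm_apply
      ((h.continuous_velocity_at s).comp (β s).continuous).neg
  have hder := (hasDerivAt_integral_of_dominated_loc_of_deriv_le (μ := volume) (𝕜 := ℝ)
    (F := fun s w => ρ (y - β s w))
    (F' := fun s w => fderiv ℝ ρ (y - β s w) (-u s (β s w)))
    (bound := (Metric.closedBall y (ε + B * r)).indicator fun _ => D * B) hJ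
    (Filter.Eventually.of_forall fun s => (hcont s).aestronglyMeasurable)
    ((hcont t).integrable_of_hasCompactSupport (HasCompactSupport.intro hKc fun w hw =>
      hρ.eq_zero (hfar t ht w hw)))
    (hcont' t).aestronglyMeasurable
    (ae_of_all _ fun w s hs => by
      by_cases hw : w ∈ Metric.closedBall y (ε + B * r)
      · rw [indicator_of_mem hw]
        refine (ContinuousLinearMap.le_opNorm _ _).trans ?_
        rw [norm_neg]
        exact mul_le_mul (hD _) (h.norm_le s (Ioo_subset_Icc_self hs) _) (norm_nonneg _) hD0
      · rw [indicator_of_notMem hw, hρ.fderiv_eq_zero (hfar s hs w hw)]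
        simp)
    ((integrable_indicator_iff Metric.isClosed_closedBall.measurableSet).2
      (integrableOn_const hKc.measure_lt_top.ne))
    (ae_of_all _ fun w s _ =>
      (hρ.differentiable _).hasFDerivAt.comp_hasDerivAt s ((h.hasDerivAt w s).const_sub y)))
  have hconst : (fun s => ∫ w, ρ (y - β s w)) = fun _ => 1 := by
    ext s
    rw [h.integral_comp_sub_flow, hρ.integral_eq_one]
  have h1 : ∫ w, fderiv ℝ ρ (y - β t w) (-u t (β t w)) = 0 := by
    have := hder.2
    rw [hconst] at this
    exact this.unique (hasDerivAt_const t 1)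
  have h2 : ∫ w, fderiv ℝ ρ (y - β t w) (u t y) = 0 := by
    rw [h.integral_comp_sub_flow (fun z => fderiv ℝ ρ z (u t y)), hρ.integral_fderiv_apply]
  have h3 : Integrable fun w => fderiv ℝ ρ (y - β t w) (u t y) :=
    ((hd.comp (continuous_const.sub (β t).continuous)).clm_apply
      continuous_const).integrable_of_hasCompactSupport (HasCompactSupport.intro hKc fun w hw => by
        simp [hρ.fderiv_eq_zero (hfar t ht w hw)])
  calc ∫ w, commutatorKernel u β ρ t w y
      = ∫ w, (fderiv ℝ ρ (y - β t w) (u t y) + fderiv ℝ ρ (y - β t w) (-u t (β t w))) := by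
        simp_rw [commutatorKernel, sub_eq_add_neg, map_add]
    _ = 0 := by rw [integral_add h3 hder.1, h1, h2, add_zero]

variable {μ : ℝ → Measure Plane} [∀ t, IsFiniteMeasure (μ t)]

/-- The mollified measure, evaluated along a trajectory, changes by the commutator only. -/
theorem IsLogLipschitzFlow.hasDerivAt_mollified (h : IsLogLipschitzFlow u β t₀ r B L)
    (hρ : IsMollifier ρ ε C)
    (hcont : ∀ φ : ZeroAtInftyContinuousMap Plane ℝ, Continuous fun t => ∫ y, φ y ∂(μ t))
    (hevol : ∀ φ : Plane → ℝ, ContDiff ℝ ∞ φ → HasCompactSupport φ → ∀ t,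
      HasDerivAt (fun t => ∫ y, φ y ∂(μ t)) (∫ y, fderiv ℝ φ y (u t y) ∂(μ t)) t)
    {t : ℝ} (ht : t ∈ Icc (t₀ - r) (t₀ + r)) (w : Plane) :
    HasDerivAt (fun s => ∫ y, ρ (y - β s w) ∂(μ s)) (∫ y, commutatorKernel u β ρ t w y ∂(μ t))
      t := by
  obtain ⟨D, hD⟩ := hρ.exists_norm_fderiv_le
  have hD0 : 0 ≤ D := (norm_nonneg _).trans (hD 0)
  have hd := hρ.continuous_fderiv
  have hdp : ∀ (t : ℝ) (p : Plane), Integrable (fun y => fderiv ℝ ρ (y - p)) (μ t) := fun t p =>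
    Integrable.of_bound (hd.comp (continuous_id.sub continuous_const)).aestronglyMeasurable D
      (ae_of_all _ fun y => hD _)
  have hcs : ∀ p, HasCompactSupport fun y => ρ (y - p) := fun p =>
    hρ.hasCompactSupport.comp_homeomorph (Homeomorph.subRight p)
  let a : ℝ → Plane → ℝ := fun t p => ∫ y, fderiv ℝ ρ (y - p) (u t y) ∂(μ t)
  let f₁ : ℝ → Plane → ℝ →L[ℝ] ℝ := fun t p => ContinuousLinearMap.toSpanSingleton ℝ (a t p)
  let f₂ : ℝ → Plane → Plane →L[ℝ] ℝ := fun t p => -∫ y, fderiv ℝ ρ (y - p) ∂(μ t)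
  have hdf₁ : ∀ v : ℝ × Plane,
      HasFDerivAt (fun s => ∫ y, ρ (y - v.2) ∂(μ s)) (f₁ v.1 v.2) v.1 := fun v => by
    have h1 := hevol (fun y => ρ (y - v.2)) (hρ.contDiff.comp (contDiff_id.sub contDiff_const))
      (hcs v.2) v.1
    simp_rw [fderiv_comp_sub] at h1
    exact h1.hasFDerivAt
  have hdf₂ : ∀ v : ℝ × Plane,
      HasFDerivAt (fun p => ∫ y, ρ (y - p) ∂(μ v.1)) (f₂ v.1 v.2) v.2 := fun v => by
    simp only [f₂, ← integral_neg]
    have hc : ∀ p, Continuous fun y => ρ (y - p) := fun p =>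
      hρ.contDiff.continuous.comp (continuous_id.sub continuous_const)
    refine hasFDerivAt_integral_of_dominated_of_fderiv_le (μ := μ v.1) (𝕜 := ℝ)
      (F := fun p y => ρ (y - p)) (F' := fun p y => -fderiv ℝ ρ (y - p)) (bound := fun _ => D)
      Filter.univ_mem (Filter.Eventually.of_forall fun p => (hc p).aestronglyMeasurable)
      ((hc _).integrable_of_hasCompactSupport (hcs _)) (hdp _ _).neg.aestronglyMeasurable
      (ae_of_all _ fun y p _ => by rw [norm_neg]; exact hD _) (integrable_const _)
      (ae_of_all _ fun y p _ => ?_)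
    have := (hρ.differentiable (y - p)).hasFDerivAt.comp p ((hasFDerivAt_id p).const_sub y)
    refine this.congr_fderiv ?_
    ext v
    simp
  -- continuity of the two partial derivatives
  have hsupp : ∀ v : ℝ × Plane, ∀ᶠ p in 𝓝 v, ∀ y ∉ Metric.closedBall v.2 (ε + 1),
      fderiv ℝ ρ (y - p.2) = 0 := fun v => by
    have h1 : ∀ᶠ p in 𝓝 v, dist p.2 v.2 < 1 :=
      (continuous_snd.tendsto v).eventually (Metric.ball_mem_nhds _ one_pos)
    filter_upwards [h1] with p hp y hy
    rw [Metric.mem_closedBall, not_le] at hy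
    refine hρ.fderiv_eq_zero ?_
    have := dist_triangle y p.2 v.2
    rw [← dist_eq_norm]
    linarith
  have hc₁ : ∀ v : ℝ × Plane, ContinuousAt (fun p : ℝ × Plane => f₁ p.1 p.2) v := fun v => by
    rw [continuousAt_clm_apply]
    intro c
    have h1 := continuousAt_integral_of_weakStar hcont (p₀ := v) continuous_fst.continuousAt
      (f := fun p y => fderiv ℝ ρ (y - p.2) (u p.1 y))
      ((hd.comp (continuous_snd.sub (continuous_snd.comp continuous_fst))).clm_apply
        (h.continuous_velocity.comp
          ((continuous_fst.comp continuous_fst).prodMk continuous_snd)))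
      (isCompact_closedBall v.2 (ε + 1)) (by
        filter_upwards [hsupp v] with p hp y hy
        simp [hp y hy])
    simpa [f₁, a] using h1.const_mul c
  have hc₂ : ∀ v : ℝ × Plane, ContinuousAt (fun p : ℝ × Plane => f₂ p.1 p.2) v := fun v => by
    rw [continuousAt_clm_apply]
    intro c
    have h1 := continuousAt_integral_of_weakStar hcont (p₀ := v) continuous_fst.continuousAt
      (f := fun p y => fderiv ℝ ρ (y - p.2) c)
      ((hd.comp (continuous_snd.sub (continuous_snd.comp continuous_fst))).clm_apply
        continuous_const)
      (isCompact_closedBall v.2 (ε + 1)) (by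
        filter_upwards [hsupp v] with p hp y hy
        simp [hp y hy])
    have h2 : (fun p : ℝ × Plane => f₂ p.1 p.2 c)
        = fun p : ℝ × Plane => -∫ y, fderiv ℝ ρ (y - p.2) c ∂(μ p.1) := by
      ext p
      simp only [f₂, neg_apply]
      rw [ContinuousLinearMap.integral_apply (hdp _ _)]
    rw [h2]
    exact h1.neg
  have hstrict := (hasStrictFDerivAt_uncurry_coprod (𝕜 := ℝ) (u := (t, β t w))
    (f := fun s p => ∫ y, ρ (y - p) ∂(μ s)) (f₁ := f₁) (f₂ := f₂)
    (Filter.Eventually.of_forall hdf₁) (Filter.Eventually.of_forall hdf₂) (hc₁ _)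
    (hc₂ _)).hasFDerivAt
  have hcurve : HasDerivAt (fun s => (s, β s w)) ((1 : ℝ), u t (β t w)) t :=
    (hasDerivAt_id t).prodMk (h.hasDerivAt w t)
  refine (hstrict.comp_hasDerivAt t hcurve).congr_deriv ?_
  have hi : Integrable (fun y => fderiv ℝ ρ (y - β t w) (u t y)) (μ t) :=
    Integrable.of_bound ((hd.comp (continuous_id.sub continuous_const)).clm_apply
      (h.continuous_velocity_at t)).aestronglyMeasurable (D * B) (ae_of_all _ fun y =>
        (ContinuousLinearMap.le_opNorm _ _).trans
          (mul_le_mul (hD _) (h.norm_le t ht _) (norm_nonneg _) hD0))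
  have hi2 := (hdp t (β t w)).apply_continuousLinearMap (u t (β t w))
  simp only [commutatorKernel, map_sub]
  rw [integral_sub hi hi2, ← ContinuousLinearMap.integral_apply (hdp t (β t w))]
  simp [f₁, f₂, a, Function.HasUncurry.uncurry, sub_eq_add_neg]

/-- The mollified measure, carried along the flow and tested with `φ`. -/
theorem IsLogLipschitzFlow.hasDerivAt_integral_mollified (h : IsLogLipschitzFlow u β t₀ r B L)
    (hρ : IsMollifier ρ ε C)
    (hcont : ∀ φ : ZeroAtInftyContinuousMap Plane ℝ, Continuous fun t => ∫ y, φ y ∂(μ t))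
    (hevol : ∀ φ : Plane → ℝ, ContDiff ℝ ∞ φ → HasCompactSupport φ → ∀ t,
      HasDerivAt (fun t => ∫ y, φ y ∂(μ t)) (∫ y, fderiv ℝ φ y (u t y) ∂(μ t)) t)
    {φ : Plane → ℝ} (hφ : Continuous φ) (hφc : HasCompactSupport φ)
    {t : ℝ} (ht : t ∈ Ioo (t₀ - r) (t₀ + r)) :
    HasDerivAt (fun s => ∫ w, φ w * ∫ y, ρ (y - β s w) ∂(μ s))
      (∫ w, φ w * ∫ y, commutatorKernel u β ρ t w y ∂(μ t)) t := by
  obtain ⟨D, hD⟩ := hρ.exists_norm_fderiv_le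
  obtain ⟨R, hR⟩ := hρ.hasCompactSupport.exists_bound_of_continuous hρ.contDiff.continuous
  obtain ⟨M, hM0, hM⟩ := exists_measureReal_univ_le hcont (t₀ - r) (t₀ + r)
  have hD0 : 0 ≤ D := (norm_nonneg _).trans (hD 0)
  have hB := h.bound_nonneg
  have hφi : Integrable φ := hφ.integrable_of_hasCompactSupport hφc
  have hm : ∀ s, StronglyMeasurable fun w => ∫ y, ρ (y - β s w) ∂(μ s) := fun s => by
    have : Continuous (Function.uncurry fun w y => ρ (y - β s w)) :=
      hρ.contDiff.continuous.comp (continuous_snd.sub ((β s).continuous.comp continuous_fst))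
    exact this.stronglyMeasurable.integral_prod_right
  have hm' : ∀ s, StronglyMeasurable fun w => ∫ y, commutatorKernel u β ρ s w y ∂(μ s) :=
    fun s => (h.continuous_commutatorKernel hρ s).stronglyMeasurable.integral_prod_right
  refine (hasDerivAt_integral_of_dominated_loc_of_deriv_le (μ := volume) (𝕜 := ℝ)
    (F := fun s w => φ w * ∫ y, ρ (y - β s w) ∂(μ s))
    (F' := fun s w => φ w * ∫ y, commutatorKernel u β ρ s w y ∂(μ s))
    (bound := fun w => |φ w| * (D * (2 * B) * M)) (isOpen_Ioo.mem_nhds ht)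
    (Filter.Eventually.of_forall fun s =>
      hφ.aestronglyMeasurable.mul (hm s).aestronglyMeasurable) ?_
    (hφ.aestronglyMeasurable.mul (hm' t).aestronglyMeasurable)
    (ae_of_all _ fun w s hs => ?_) (hφi.abs.mul_const _) (ae_of_all _ fun w s hs => ?_)).2
  · refine hφi.mul_bdd (c := R * (μ t).real univ) (hm t).aestronglyMeasurable
      (ae_of_all _ fun w => ?_)
    exact norm_integral_le_of_norm_le_const (ae_of_all _ fun y => hR _)
  · rw [norm_mul, Real.norm_eq_abs]
    refine mul_le_mul_of_nonneg_left ?_ (abs_nonneg _)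
    refine (norm_integral_le_of_norm_le_const (C := D * (2 * B))
      (ae_of_all _ fun y => ?_)).trans ?_
    · refine (ContinuousLinearMap.le_opNorm _ _).trans
        (mul_le_mul (hD _) ((_root_.norm_sub_le _ _).trans ?_) (norm_nonneg _) hD0)
      linarith [h.norm_le s (Ioo_subset_Icc_self hs) y,
        h.norm_le s (Ioo_subset_Icc_self hs) (β s w)]
    · gcongr
      exact hM s (Ioo_subset_Icc_self hs)
  · exact (h.hasDerivAt_mollified hρ hcont hevol (Ioo_subset_Icc_self hs) w).const_mul _

/-- A weak solution of the transport equation is transported by the flow, as long as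
`L |t - t₀| ≤ 1 / 2`. With mollification at scale `ε = exp (-S)` the commutator is of size
`S * exp (L S |t - t₀|) * ε`, which vanishes as `S → ∞`. -/
theorem IsLogLipschitzFlow.map_symm_eq (h : IsLogLipschitzFlow u β t₀ r B L)
    (hLr : L * r ≤ 1 / 2)
    (hcont : ∀ φ : ZeroAtInftyContinuousMap Plane ℝ, Continuous fun t => ∫ y, φ y ∂(μ t))
    (hevol : ∀ φ : Plane → ℝ, ContDiff ℝ ∞ φ → HasCompactSupport φ → ∀ t,
      HasDerivAt (fun t => ∫ y, φ y ∂(μ t)) (∫ y, fderiv ℝ φ y (u t y) ∂(μ t)) t)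
    {t : ℝ} (ht : t ∈ Ioo (t₀ - r) (t₀ + r)) : (μ t).map (β t).symm = μ t₀ := by
  have := Measure.isFiniteMeasure_map (μ t) (β t).symm
  refine measure_ext_of_integral_contDiff fun φ hφ hφc => ?_
  rw [integral_map (β t).symm.continuous.aemeasurable hφ.continuous.aestronglyMeasurable]
  obtain ⟨Λ, hΛ⟩ := ContDiff.lipschitzWith_of_hasCompactSupport hφc hφ (by simp)
  have hφΛ : ∀ a b, |φ a - φ b| ≤ Λ * ‖a - b‖ := fun a b => by
    simpa [dist_eq_norm] using hΛ.dist_le_mul a b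
  obtain ⟨C, hC0, hmol⟩ := exists_isMollifier
  obtain ⟨M, hM0, hM⟩ := exists_measureReal_univ_le hcont (t₀ - r) (t₀ + r)
  have hr := h.radius_pos
  have hL := h.const_pos
  have ht₀ : t₀ ∈ Ioo (t₀ - r) (t₀ + r) := ⟨by linarith, by linarith⟩
  have hexp : ∀ S, 1 ≤ S → ∀ s ∈ Ioo (t₀ - r) (t₀ + r),
      2 * Real.exp (-S) * Real.exp (L * S * |s - t₀|) ≤ 2 * Real.exp (-(S / 2)) := by
    intro S hS s hs
    rw [mul_assoc, ← Real.exp_add]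
    gcongr
    have h1 : |s - t₀| ≤ r := abs_le.2 ⟨by linarith [hs.1], by linarith [hs.2]⟩
    have h2 : L * S * |s - t₀| ≤ L * S * r := by gcongr
    nlinarith
  have key : ∀ S : ℝ, 1 ≤ S →
      |(∫ y, φ ((β t).symm y) ∂(μ t)) - ∫ y, φ y ∂(μ t₀)| ≤
        Real.exp (-(S / 2)) * (4 * Λ * M + 2 * Λ * L * C * M * r * (S + 1)) := by
    intro S hS
    obtain ⟨ρ, hρ⟩ := hmol (Real.exp (-S)) (Real.exp_pos _)
    -- the error of mollification
    have hA : ∀ s ∈ Ioo (t₀ - r) (t₀ + r),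
        |(∫ w, φ w * ∫ y, ρ (y - β s w) ∂(μ s)) - ∫ y, φ ((β s).symm y) ∂(μ s)| ≤
          2 * Λ * M * Real.exp (-(S / 2)) := by
      intro s hs
      have h1 := h.abs_integral_integral_sub_le (Ioo_subset_Icc_self hs) hS (ν := μ s)
        hφ.continuous hφc Λ.2 hφΛ (G := fun w y => ρ (y - β s w)) (k := ρ) (κ := 1)
        (hρ.contDiff.continuous.comp (continuous_snd.sub ((β s).continuous.comp continuous_fst)))
        hρ.contDiff.continuous (fun z hz => hρ.eq_zero hz)
        (fun w y => (abs_of_nonneg (hρ.nonneg _)).le)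
        (fun y => by rw [h.integral_comp_sub_flow, hρ.integral_eq_one])
      rw [one_mul, hρ.integral_eq_one, mul_one] at h1
      refine h1.trans ?_
      calc _ ≤ Λ * (2 * Real.exp (-(S / 2))) * M :=
            mul_le_mul (mul_le_mul_of_nonneg_left (hexp S hS s hs) Λ.2)
              (hM s (Ioo_subset_Icc_self hs)) measureReal_nonneg (by positivity)
        _ = _ := by ring
    -- the bound of the commutator
    have hA' : ∀ s ∈ Ioo (t₀ - r) (t₀ + r),
        ‖∫ w, φ w * ∫ y, commutatorKernel u β ρ s w y ∂(μ s)‖ ≤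
          2 * Λ * L * C * M * (S + 1) * Real.exp (-(S / 2)) := by
      intro s hs
      have hmod : ∀ w y, |commutatorKernel u β ρ s w y| ≤
          L * ((S + 1) * Real.exp (-S)) * ‖fderiv ℝ ρ (y - β s w)‖ := by
        intro w y
        refine ((fderiv ℝ ρ (y - β s w)).le_opNorm (u s y - u s (β s w))).trans ?_
        by_cases hw : Real.exp (-S) < ‖y - β s w‖
        · simp [hρ.fderiv_eq_zero hw]
        · rw [mul_comm]
          refine mul_le_mul_of_nonneg_right ?_ (norm_nonneg _)
          refine (h.norm_sub_le s (Ioo_subset_Icc_self hs) S (by linarith) _ _).trans ?_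
          refine mul_le_mul_of_nonneg_left ?_ hL.le
          have := mul_le_mul_of_nonneg_left (not_lt.1 hw) (by linarith : 0 ≤ S)
          linarith
      have h1 := h.abs_integral_integral_sub_le (Ioo_subset_Icc_self hs) hS (ν := μ s)
        hφ.continuous hφc Λ.2 hφΛ (G := commutatorKernel u β ρ s)
        (k := fun z => L * ((S + 1) * Real.exp (-S)) * ‖fderiv ℝ ρ z‖) (κ := 0)
        (h.continuous_commutatorKernel hρ s) (continuous_const.mul hρ.continuous_fderiv.norm)
        (fun z hz => by simp [hρ.fderiv_eq_zero hz]) hmod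
        (fun y => h.integral_commutatorKernel hρ hs y)
      rw [zero_mul, sub_zero, integral_const_mul] at h1
      refine h1.trans ?_
      have h2 : L * ((S + 1) * Real.exp (-S)) * ∫ z, ‖fderiv ℝ ρ z‖ ≤ L * (S + 1) * C := by
        calc _ ≤ L * ((S + 1) * Real.exp (-S)) * (C / Real.exp (-S)) := by
              refine mul_le_mul_of_nonneg_left hρ.integral_norm_fderiv_le ?_
              have : 0 ≤ S + 1 := by linarith
              positivity
          _ = _ := by field_simp
      have h3 : 0 ≤ L * ((S + 1) * Real.exp (-S)) * ∫ z, ‖fderiv ℝ ρ z‖ := by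
        have h4 : 0 ≤ S + 1 := by linarith
        have h5 : 0 ≤ ∫ z, ‖fderiv ℝ ρ z‖ := integral_nonneg fun _ => norm_nonneg _
        positivity
      have h6 : (0 : ℝ) ≤ Λ * (2 * Real.exp (-(S / 2))) := by positivity
      calc _ ≤ Λ * (2 * Real.exp (-(S / 2))) * (L * (S + 1) * C) * M :=
            mul_le_mul (mul_le_mul (mul_le_mul_of_nonneg_left (hexp S hS s hs) Λ.2) h2 h3 h6)
              (hM s (Ioo_subset_Icc_self hs)) measureReal_nonneg (mul_nonneg h6 (h3.trans h2))
        _ = _ := by ring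
    have hdiff := (convex_Ioo (t₀ - r) (t₀ + r)).norm_image_sub_le_of_norm_hasDerivWithin_le
      (f := fun s => ∫ w, φ w * ∫ y, ρ (y - β s w) ∂(μ s))
      (fun s hs => (h.hasDerivAt_integral_mollified hρ hcont hevol hφ.continuous hφc
        hs).hasDerivWithinAt) hA' ht₀ ht
    have h1 := hA t ht
    have h2 := hA t₀ ht₀
    have hbase : ∀ y, (β t₀).symm y = y := fun y => by
      rw [Homeomorph.symm_apply_eq, h.base]
    simp_rw [hbase] at h2
    have h3 : ‖t - t₀‖ ≤ r := abs_le.2 ⟨by linarith [ht.1], by linarith [ht.2]⟩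
    have h4 : 2 * Λ * L * C * M * (S + 1) * Real.exp (-(S / 2)) * ‖t - t₀‖ ≤
        2 * Λ * L * C * M * (S + 1) * Real.exp (-(S / 2)) * r := by
      have h5 : 0 ≤ S + 1 := by linarith
      gcongr
    have h6 := hdiff.trans h4
    rw [Real.norm_eq_abs] at h6
    rw [abs_sub_comm] at h1
    have h7 := abs_add_three
      ((∫ y, φ ((β t).symm y) ∂(μ t)) - ∫ w, φ w * ∫ y, ρ (y - β t w) ∂(μ t))
      ((∫ w, φ w * ∫ y, ρ (y - β t w) ∂(μ t)) - ∫ w, φ w * ∫ y, ρ (y - β t₀ w) ∂(μ t₀))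
      ((∫ w, φ w * ∫ y, ρ (y - β t₀ w) ∂(μ t₀)) - ∫ y, φ y ∂(μ t₀))
    rw [sub_add_sub_cancel, sub_add_sub_cancel] at h7
    linarith
  have hlim : Filter.Tendsto (fun S : ℝ => Real.exp (-(S / 2)) *
      (4 * Λ * M + 2 * Λ * L * C * M * r * (S + 1))) Filter.atTop (𝓝 0) := by
    have h1 : Filter.Tendsto (fun S : ℝ => S / 2) Filter.atTop Filter.atTop :=
      Filter.tendsto_id.atTop_div_const two_pos
    have h2 := (Real.tendsto_pow_mul_exp_neg_atTop_nhds_zero 1).comp h1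
    have h3 := Real.tendsto_exp_neg_atTop_nhds_zero.comp h1
    have h4 := (h3.mul_const (4 * Λ * M + 2 * Λ * L * C * M * r)).add
      (h2.mul_const (2 * (2 * Λ * L * C * M * r)))
    rw [zero_mul, zero_mul, add_zero] at h4
    refine h4.congr fun S => ?_
    simp only [Function.comp_apply, pow_one]
    ring
  have h0 := ge_of_tendsto hlim (Filter.eventually_atTop.2 ⟨1, key⟩)
  exact sub_eq_zero.1 (abs_nonpos_iff.1 h0)

end

/-- The vorticity of an Euler-`α` solution, if it is nonnegative, is the image of its initial value
under the flow. -/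
theorem map_flow_symm_eq {α : ℝ} (hα : 0 < α) {qin : SignedMeasure Plane}
    {η : ℝ → Plane ≃ₜ Plane} {u : ℝ → C(Plane, Plane)} {q : ℝ → SignedMeasure Plane}
    (hsol : IsEulerAlphaSolution α qin η u q) {μ : ℝ → Measure Plane} [∀ t, IsFiniteMeasure (μ t)]
    (hμ : ∀ t, q t = (μ t).toSignedMeasure) (t : ℝ) : (μ t).map (η t).symm = μ 0 := by
  have hcont : ∀ φ : ZeroAtInftyContinuousMap Plane ℝ, Continuous fun t => ∫ y, φ y ∂(μ t) :=
    fun φ => by simpa [hμ] using hsol.vorticity_continuous φ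
  have htr : ∀ ψ : ℝ × Plane → ℝ, ContDiff ℝ ∞ ψ → HasCompactSupport ψ →
      ∫ t : ℝ, (∫ y, fderiv ℝ ψ (t, y) (1, u t y) ∂(μ t)) = 0 := fun ψ h1 h2 => by
    simpa [hμ] using hsol.transport ψ h1 h2
  have hevol : ∀ φ : Plane → ℝ, ContDiff ℝ ∞ φ → HasCompactSupport φ → ∀ t,
      HasDerivAt (fun t => ∫ y, φ y ∂(μ t)) (∫ y, fderiv ℝ φ y (u t y) ∂(μ t)) t :=
    fun φ h1 h2 => hasDerivAt_integral_of_transport hsol.velocity_continuous hcont htr h1 h2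
  obtain ⟨C, hC, hmod⟩ := exists_norm_alphaKernel_sub_le hα
  obtain ⟨D, hD, hbd⟩ := exists_norm_alphaKernel_le hα
  have hu : ∀ t y, u t y = ∫ z, alphaKernel α (y - z) ∂(μ t) := fun t y => by
    rw [hsol.velocity_eq, hμ, VectorMeasure.integral_toSignedMeasure]
  have hi : ∀ t y, Integrable (fun z => alphaKernel α (y - z)) (μ t) := fun t y =>
    Integrable.of_bound ((continuous_alphaKernel hα).comp
      (continuous_const.sub continuous_id)).aestronglyMeasurable D (ae_of_all _ fun z => hbd _)
  have hloc : ∀ t₀, ∃ r > 0, ∀ t ∈ Ioo (t₀ - r) (t₀ + r),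
      (μ t).map (η t).symm = (μ t₀).map (η t₀).symm := by
    intro t₀
    obtain ⟨M, hM0, hM⟩ := exists_measureReal_univ_le hcont (t₀ - 1) (t₀ + 1)
    have hL : 0 < C * (M + 1) := by positivity
    have hr : 0 < min 1 (1 / (2 * (C * (M + 1)))) := by positivity
    have hM' : ∀ t ∈ Icc (t₀ - min 1 (1 / (2 * (C * (M + 1)))))
        (t₀ + min 1 (1 / (2 * (C * (M + 1))))), (μ t).real univ ≤ M := fun t ht =>
      hM t (Icc_subset_Icc (by gcongr; exact min_le_left _ _)
        (by gcongr; exact min_le_left _ _) ht)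
    refine ⟨_, hr, fun t ht => ?_⟩
    have hflow : IsLogLipschitzFlow (fun t y => u t y) (fun t => (η t₀).symm.trans (η t)) t₀
        (min 1 (1 / (2 * (C * (M + 1))))) (D * M) (C * (M + 1)) :=
      { radius_pos := hr
        const_pos := hL
        continuous_velocity := by
          have := hsol.velocity_continuous
          fun_prop
        measurePreserving := fun t => by
          have h1 : MeasurePreserving (η t₀).symm volume volume :=
            (hsol.flow_measurePreserving t₀).symm (e := (η t₀).toMeasurableEquiv)
          exact (hsol.flow_measurePreserving t).comp h1
        base := fun y => by simp
        hasDerivAt := fun y t => hsol.flow_deriv _ t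
        norm_le := fun t ht y => by
          rw [hu]
          refine (norm_integral_le_of_norm_le_const (ae_of_all _ fun z => hbd _)).trans ?_
          gcongr
          exact hM' t ht
        norm_sub_le := fun t ht S hS y z => by
          rw [hu, hu, ← integral_sub (hi _ _) (hi _ _)]
          refine (norm_integral_le_of_norm_le_const (C := C * (S * ‖y - z‖ + Real.exp (-S)))
            (ae_of_all _ fun a => ?_)).trans ?_
          · simpa using hmod S hS (y - a) (z - a)
          · have h1 := hM' t ht
            have h2 : 0 ≤ C * (S * ‖y - z‖ + Real.exp (-S)) := by positivity
            calc _ ≤ C * (S * ‖y - z‖ + Real.exp (-S)) * (M + 1) := by gcongr; linarith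
              _ = _ := by ring }
    have hLr : C * (M + 1) * min 1 (1 / (2 * (C * (M + 1)))) ≤ 1 / 2 := by
      calc _ ≤ C * (M + 1) * (1 / (2 * (C * (M + 1)))) := by gcongr; exact min_le_right _ _
        _ = 1 / 2 := by field_simp
    rw [← hflow.map_symm_eq hLr hcont hevol ht,
      Measure.map_map (η t₀).symm.measurable (Homeomorph.measurable _)]
    congr 1
    ext1 y
    simp
  have hlc : IsLocallyConstant fun t => (μ t).map (η t).symm := by
    rw [IsLocallyConstant.iff_eventually_eq]
    intro t₀
    obtain ⟨r, hr, h⟩ := hloc t₀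
    exact Filter.eventually_of_mem (Ioo_mem_nhds (by linarith) (by linarith)) h
  rw [hlc.apply_eq_of_preconnectedSpace t 0]
  have : ⇑(η 0).symm = id := by
    ext1 y
    rw [Homeomorph.symm_apply_eq, hsol.flow_zero, id]
  rw [this, Measure.map_id]

/-! ### Circulation along an interval -/

section
variable {I : Set ℝ} {w : ℝ → ℝ} {a : ℝ}

lemma ae_mem_interior_of_ordConnected (hI : I.OrdConnected) :
    ∀ᵐ σ ∂volume.restrict I, σ ∈ interior I := by
  have h1 : volume (frontier I) = 0 := hI.convex.addHaar_frontier volume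
  rw [ae_restrict_iff' hI.measurableSet]
  filter_upwards [measure_eq_zero_iff_ae_notMem.1 h1] with σ hσ hσI
  by_contra h
  exact hσ ⟨subset_closure hσI, h⟩

lemma intervalIntegrable_of_mem (hI : I.OrdConnected) (hw : IntegrableOn w I) {s t : ℝ}
    (hs : s ∈ I) (ht : t ∈ I) : IntervalIntegrable w volume s t :=
  (hw.mono_set (hI.uIcc_subset hs ht)).intervalIntegrable

/-- The Lebesgue differentiation theorem for the circulation. -/
lemma ae_hasDerivAt_circulation (hI : I.OrdConnected) (hw : IntegrableOn w I) (ha : a ∈ I) :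
    ∀ᵐ σ ∂volume.restrict I, HasDerivAt (fun s => ∫ r in a..s, w r) (w σ) σ := by
  have h1 := LocallyIntegrable.ae_hasDerivAt_integral
    ((integrable_indicator_iff hI.measurableSet).2 hw).locallyIntegrable
  filter_upwards [ae_mem_interior_of_ordConnected hI, ae_restrict_of_ae h1] with σ hσ hd
  have hd' := hd a
  rw [indicator_of_mem (interior_subset hσ)] at hd'
  refine hd'.congr_of_eventuallyEq ?_
  filter_upwards [mem_interior_iff_mem_nhds.1 hσ] with s hs
  exact intervalIntegral.integral_congr fun r hr =>
    (indicator_of_mem (hI.uIcc_subset ha hs hr) w).symm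

lemma ae_nonneg_of_strictMonoOn (hI : I.OrdConnected) (hw : IntegrableOn w I) (ha : a ∈ I)
    (hmono : StrictMonoOn (fun σ => ∫ r in a..σ, w r) I) :
    ∀ᵐ σ ∂volume.restrict I, 0 ≤ w σ := by
  filter_upwards [ae_mem_interior_of_ordConnected hI, ae_hasDerivAt_circulation hI hw ha]
    with σ hσ hd
  have h1 := (hmono.monotoneOn.mono interior_subset).derivWithin_nonneg (x := σ)
  rwa [hd.hasDerivWithinAt.derivWithin (isOpen_interior.uniqueDiffWithinAt hσ)] at h1

lemma continuousOn_circulation (hI : I.OrdConnected) (hw : IntegrableOn w I) (ha : a ∈ I) :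
    ContinuousOn (fun σ => ∫ r in a..σ, w r) I := by
  have h1 : Continuous fun σ => ∫ r in a..σ, I.indicator w r :=
    intervalIntegral.continuous_primitive (fun _ _ =>
      ((integrable_indicator_iff hI.measurableSet).2 hw).intervalIntegrable) a
  refine h1.continuousOn.congr fun σ hσ => ?_
  exact intervalIntegral.integral_congr fun r hr =>
    (indicator_of_mem (hI.uIcc_subset ha hσ hr) w).symm

lemma abs_circulation_le (hI : I.OrdConnected) (hw : IntegrableOn w I) (ha : a ∈ I) {σ : ℝ}
    (hσ : σ ∈ I) : |∫ r in a..σ, w r| ≤ ∫ r in I, |w r| := by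
  refine (intervalIntegral.norm_integral_le_integral_norm_uIoc (f := w)).trans ?_
  exact setIntegral_mono_set hw.norm (ae_of_all _ fun _ => norm_nonneg _)
    (uIoc_subset_uIcc.trans (hI.uIcc_subset ha hσ)).eventuallyLE

/-- The measure `w dσ` on `I`; negative values of `w` count as `0`. -/
noncomputable def circulationMeasure (I : Set ℝ) (w : ℝ → ℝ) : Measure ℝ :=
  (volume.restrict I).withDensity fun σ => ENNReal.ofReal (w σ)

lemma circulationMeasure_absolutelyContinuous :
    circulationMeasure I w ≪ volume.restrict I := withDensity_absolutelyContinuous _ _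

lemma isFiniteMeasure_circulationMeasure (hw : IntegrableOn w I) :
    IsFiniteMeasure (circulationMeasure I w) := isFiniteMeasure_withDensity_ofReal hw.2

lemma circulationMeasure_Ioc (hI : I.OrdConnected) (hw : IntegrableOn w I)
    (hnn : ∀ᵐ σ ∂volume.restrict I, 0 ≤ w σ) {s t : ℝ} (hs : s ∈ I) (ht : t ∈ I) (hst : s ≤ t) :
    circulationMeasure I w (Ioc s t) = ENNReal.ofReal (∫ r in s..t, w r) := by
  have hsub : Ioc s t ⊆ I := Ioc_subset_Icc_self.trans (hI.out hs ht)
  rw [circulationMeasure, withDensity_apply _ measurableSet_Ioc,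
    Measure.restrict_restrict measurableSet_Ioc, inter_eq_left.2 hsub,
    intervalIntegral.integral_of_le hst,
    ofReal_integral_eq_lintegral_ofReal (hw.mono_set hsub)
      (ae_mono (Measure.restrict_mono_set _ hsub) hnn)]

lemma circulationMeasure_singleton (σ : ℝ) : circulationMeasure I w {σ} = 0 :=
  (circulationMeasure_absolutelyContinuous.trans
    (Measure.absolutelyContinuous_of_le Measure.restrict_le_self)) (measure_singleton σ)

lemma circulationMeasure_Ioo (hI : I.OrdConnected) (hw : IntegrableOn w I)
    (hnn : ∀ᵐ σ ∂volume.restrict I, 0 ≤ w σ) {s t : ℝ} (hs : s ∈ I) (ht : t ∈ I) (hst : s ≤ t) :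
    circulationMeasure I w (Ioo s t) = ENNReal.ofReal (∫ r in s..t, w r) := by
  rw [← circulationMeasure_Ioc hI hw hnn hs ht hst, ← Ioc_sdiff_right,
    measure_sdiff_null (circulationMeasure_singleton t)]

/-- The circulation of an arc is the measure of the arc, for a simple curve. -/
theorem curveMeasure_image_Ioo {x : ℝ → Plane} (hI : I.OrdConnected) (hx : ContinuousOn x I)
    (hw : IntegrableOn w I) (hnn : ∀ᵐ σ ∂volume.restrict I, 0 ≤ w σ)
    (hinj : InjOn x (interior I)) {s t : ℝ} (hs : s ∈ I) (ht : t ∈ I) (hst : s ≤ t) :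
    (curveMeasure I x w).real (x '' Ioo s t) = ∫ r in s..t, w r := by
  have hsub : Ioo s t ⊆ interior I := interior_maximal
    (Ioo_subset_Icc_self.trans (hI.out hs ht)) isOpen_Ioo
  have hxm : AEMeasurable x (circulationMeasure I w) :=
    (hx.aemeasurable hI.measurableSet).mono_ac circulationMeasure_absolutelyContinuous
  have hmeas : MeasurableSet (x '' Ioo s t) := measurableSet_Ioo.image_of_continuousOn_injOn
    (hx.mono (hsub.trans interior_subset)) (hinj.mono hsub)
  have h1 : circulationMeasure I w (x ⁻¹' (x '' Ioo s t)) = circulationMeasure I w (Ioo s t) := by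
    refine measure_congr ?_
    filter_upwards [circulationMeasure_absolutelyContinuous.ae_le
      (ae_mem_interior_of_ordConnected hI)] with σ hσ
    refine propext ⟨fun h => ?_, fun h => mem_image_of_mem x h⟩
    obtain ⟨r, hr, hrσ⟩ := h
    rwa [← hinj (hsub hr) hσ hrσ]
  rw [measureReal_def, curveMeasure, ← circulationMeasure, Measure.map_apply_of_aemeasurable hxm
    hmeas, h1, circulationMeasure_Ioo hI hw hnn hs ht hst, ENNReal.toReal_ofReal]
  exact intervalIntegral.integral_nonneg_of_ae_restrict hst
    (ae_mono (Measure.restrict_mono_set _ (hI.out hs ht)) hnn)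

end

/-! ### The curve parametrized by circulation -/

section
variable {I : Set ℝ} {w : ℝ → ℝ} {a : ℝ}

/-- The interior of the range of the circulation `σ ↦ ∫_a^σ w` on `I`. -/
abbrev circulationInterval (I : Set ℝ) (w : ℝ → ℝ) (a : ℝ) : Set ℝ :=
  Ioo (sInf ((fun σ => ∫ r in a..σ, w r) '' I)) (sSup ((fun σ => ∫ r in a..σ, w r) '' I))

lemma bddBelow_circulation_image (hI : I.OrdConnected) (hw : IntegrableOn w I) (ha : a ∈ I) :
    BddBelow ((fun σ => ∫ r in a..σ, w r) '' I) :=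
  ⟨-∫ r in I, |w r|, by
    rintro _ ⟨σ, hσ, rfl⟩
    exact (abs_le.1 (abs_circulation_le hI hw ha hσ)).1⟩

lemma bddAbove_circulation_image (hI : I.OrdConnected) (hw : IntegrableOn w I) (ha : a ∈ I) :
    BddAbove ((fun σ => ∫ r in a..σ, w r) '' I) :=
  ⟨∫ r in I, |w r|, by
    rintro _ ⟨σ, hσ, rfl⟩
    exact (abs_le.1 (abs_circulation_le hI hw ha hσ)).2⟩

lemma circulation_image_subset_Icc (hI : I.OrdConnected) (hw : IntegrableOn w I) (ha : a ∈ I) :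
    (fun σ => ∫ r in a..σ, w r) '' I ⊆ Icc (sInf ((fun σ => ∫ r in a..σ, w r) '' I))
      (sSup ((fun σ => ∫ r in a..σ, w r) '' I)) := fun _ hg =>
  ⟨csInf_le (bddBelow_circulation_image hI hw ha) hg,
    le_csSup (bddAbove_circulation_image hI hw ha) hg⟩

lemma ordConnected_circulation_image (hI : I.OrdConnected) (hw : IntegrableOn w I) (ha : a ∈ I) :
    ((fun σ => ∫ r in a..σ, w r) '' I).OrdConnected :=
  (hI.isPreconnected.image _ (continuousOn_circulation hI hw ha)).ordConnected

lemma Ioo_subset_circulation_image (hI : I.OrdConnected) (hw : IntegrableOn w I) (ha : a ∈ I) :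
    circulationInterval I w a ⊆ (fun σ => ∫ r in a..σ, w r) '' I :=
  IsConnected.Ioo_csInf_csSup_subset
    (IsConnected.image ⟨⟨a, ha⟩, hI.isPreconnected⟩ _ (continuousOn_circulation hI hw ha))
    (bddBelow_circulation_image hI hw ha) (bddAbove_circulation_image hI hw ha)

lemma sInf_circulation_lt_sSup (hI : I.OrdConnected) (hIn : I.Nontrivial) (hw : IntegrableOn w I)
    (ha : a ∈ I) (hmono : StrictMonoOn (fun σ => ∫ r in a..σ, w r) I) :
    sInf ((fun σ => ∫ r in a..σ, w r) '' I) < sSup ((fun σ => ∫ r in a..σ, w r) '' I) := by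
  obtain ⟨s, hs, t, ht, hst⟩ := hIn.exists_lt
  exact ((circulation_image_subset_Icc hI hw ha ⟨s, hs, rfl⟩).1.trans_lt (hmono hs ht hst)).trans_le
    (circulation_image_subset_Icc hI hw ha ⟨t, ht, rfl⟩).2

lemma circulation_mem_Ioo (hI : I.OrdConnected) (hw : IntegrableOn w I) (ha : a ∈ I)
    (hmono : StrictMonoOn (fun σ => ∫ r in a..σ, w r) I) {σ : ℝ} (hσ : σ ∈ interior I) :
    ∫ r in a..σ, w r ∈ circulationInterval I w a := by
  obtain ⟨l, m, hlm, hsub⟩ := mem_nhds_iff_exists_Ioo_subset.1 (mem_interior_iff_mem_nhds.1 hσ)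
  obtain ⟨s, hs1, hs2⟩ := exists_between hlm.1
  obtain ⟨t, ht1, ht2⟩ := exists_between hlm.2
  have hs : s ∈ I := hsub ⟨hs1, hs2.trans hlm.2⟩
  have ht : t ∈ I := hsub ⟨hlm.1.trans ht1, ht2⟩
  have hσ' := interior_subset hσ
  exact ⟨(circulation_image_subset_Icc hI hw ha ⟨s, hs, rfl⟩).1.trans_lt (hmono hs hσ' hs2),
    (hmono hσ' ht ht1).trans_le (circulation_image_subset_Icc hI hw ha ⟨t, ht, rfl⟩).2⟩

lemma aemeasurable_circulation (hI : I.OrdConnected) (hw : IntegrableOn w I) (ha : a ∈ I) :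
    AEMeasurable (fun σ => ∫ r in a..σ, w r) (circulationMeasure I w) :=
  ((continuousOn_circulation hI hw ha).aemeasurable hI.measurableSet).mono_ac
    circulationMeasure_absolutelyContinuous

lemma map_circulation_Ioc (hI : I.OrdConnected) (hw : IntegrableOn w I) (ha : a ∈ I)
    (hmono : StrictMonoOn (fun σ => ∫ r in a..σ, w r) I) {c d : ℝ} (hcd : c ≤ d)
    (hc : c ∈ (fun σ => ∫ r in a..σ, w r) '' I) (hd : d ∈ (fun σ => ∫ r in a..σ, w r) '' I) :
    (circulationMeasure I w).map (fun σ => ∫ r in a..σ, w r) (Ioc c d)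
      = ENNReal.ofReal (d - c) := by
  obtain ⟨s, hs, rfl⟩ := hc
  obtain ⟨t, ht, rfl⟩ := hd
  have hst : s ≤ t := (hmono.le_iff_le hs ht).1 hcd
  rw [Measure.map_apply_of_aemeasurable (aemeasurable_circulation hI hw ha) measurableSet_Ioc]
  have h1 : circulationMeasure I w ((fun σ => ∫ r in a..σ, w r) ⁻¹'
      Ioc (∫ r in a..s, w r) (∫ r in a..t, w r)) = circulationMeasure I w (Ioc s t) := by
    refine measure_congr ?_
    filter_upwards [circulationMeasure_absolutelyContinuous.ae_le
      (ae_restrict_mem hI.measurableSet)] with σ hσ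
    exact propext (and_congr (hmono.lt_iff_lt hs hσ) (hmono.le_iff_le hσ ht))
  rw [h1, circulationMeasure_Ioc hI hw (ae_nonneg_of_strictMonoOn hI hw ha hmono) hs ht hst,
    intervalIntegral.integral_interval_sub_left (intervalIntegrable_of_mem hI hw ha ht)
      (intervalIntegrable_of_mem hI hw ha hs)]

/-- The circulation maps the vorticity of the curve to the Lebesgue measure. -/
theorem map_circulation (hI : I.OrdConnected) (hIn : I.Nontrivial) (hw : IntegrableOn w I)
    (ha : a ∈ I) (hmono : StrictMonoOn (fun σ => ∫ r in a..σ, w r) I) :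
    (circulationMeasure I w).map (fun σ => ∫ r in a..σ, w r) =
      volume.restrict (circulationInterval I w a) := by
  have hlt := sInf_circulation_lt_sSup hI hIn hw ha hmono
  have hIoo := Ioo_subset_circulation_image hI hw ha
  have hoc := ordConnected_circulation_image hI hw ha
  have hIoc := fun {c d : ℝ} (hcd : c ≤ d) => map_circulation_Ioc hI hw ha hmono hcd
  have := isFiniteMeasure_circulationMeasure hw
  have hfin := Measure.isFiniteMeasure_map (circulationMeasure I w) fun σ => ∫ r in a..σ, w r
  have hae : ∀ᵐ g ∂(circulationMeasure I w).map (fun σ => ∫ r in a..σ, w r),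
      g ∈ circulationInterval I w a := by
    refine (ae_map_iff (aemeasurable_circulation hI hw ha) measurableSet_Ioo).2 ?_
    filter_upwards [circulationMeasure_absolutelyContinuous.ae_le
      (ae_mem_interior_of_ordConnected hI)] with σ hσ
    exact circulation_mem_Ioo hI hw ha hmono hσ
  set R := (fun σ => ∫ r in a..σ, w r) '' I
  set m := (circulationMeasure I w).map (fun σ => ∫ r in a..σ, w r)
  obtain ⟨c₀, hc₀⟩ := exists_between hlt
  obtain ⟨c, -, hc, hclim⟩ := exists_seq_strictAnti_tendsto' hc₀.1
  obtain ⟨d, -, hd, hdlim⟩ := exists_seq_strictMono_tendsto' hc₀.2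
  have hunion : circulationInterval I w a = ⋃ n, Ioc (c n) (d n) := by
    ext g
    rw [mem_iUnion]
    refine ⟨fun hg => ?_, fun ⟨n, hn⟩ => ⟨(hc n).1.trans hn.1, hn.2.trans_lt (hd n).2⟩⟩
    obtain ⟨n, h1, h2⟩ := ((hclim.eventually_lt_const hg.1).and
      (hdlim.eventually_const_lt hg.2)).exists
    exact ⟨n, h1, h2.le⟩
  rw [← Measure.restrict_eq_self_of_ae_mem hae, hunion, Measure.restrict_iUnion_congr]
  intro n
  have hcn : c n ∈ R := hIoo ⟨(hc n).1, (hc n).2.trans hc₀.2⟩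
  have hdn : d n ∈ R := hIoo ⟨hc₀.1.trans (hd n).1, (hd n).2⟩
  refine Measure.ext_of_Ioc _ _ fun p q _ => ?_
  rw [Measure.restrict_apply measurableSet_Ioc, Measure.restrict_apply measurableSet_Ioc,
    Ioc_inter_Ioc]
  rcases le_or_gt (p ⊔ c n) (q ⊓ d n) with hle | hlt'
  · rw [hIoc hle (hoc.out hcn hdn ⟨le_sup_right, hle.trans inf_le_right⟩)
      (hoc.out hcn hdn ⟨le_sup_right.trans hle, inf_le_right⟩), Real.volume_Ioc]
  · rw [Ioc_eq_empty (not_lt.2 hlt'.le), measure_empty, measure_empty]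

/-- The parameter of the point of a given circulation. Outside the range of the circulation its
value is arbitrary. -/
noncomputable def circulationInv (I : Set ℝ) (w : ℝ → ℝ) (a : ℝ) : ℝ → ℝ :=
  Function.invFunOn (fun σ => ∫ r in a..σ, w r) I

lemma circulationInv_circulation (hmono : StrictMonoOn (fun σ => ∫ r in a..σ, w r) I) {σ : ℝ}
    (hσ : σ ∈ I) : circulationInv I w a (∫ r in a..σ, w r) = σ :=
  hmono.injOn.leftInvOn_invFunOn hσ

lemma circulation_circulationInv {g : ℝ} (hg : g ∈ (fun σ => ∫ r in a..σ, w r) '' I) :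
    ∫ r in a..circulationInv I w a g, w r = g := Function.invFunOn_eq hg

lemma monotoneOn_circulationInv (hmono : StrictMonoOn (fun σ => ∫ r in a..σ, w r) I) :
    MonotoneOn (circulationInv I w a) ((fun σ => ∫ r in a..σ, w r) '' I) := by
  rintro _ ⟨s, hs, rfl⟩ _ ⟨t, ht, rfl⟩ hst
  simp only [circulationInv_circulation hmono hs, circulationInv_circulation hmono ht]
  exact (hmono.le_iff_le hs ht).1 hst

lemma aemeasurable_circulationInv (hI : I.OrdConnected) (hw : IntegrableOn w I) (ha : a ∈ I)
    (hmono : StrictMonoOn (fun σ => ∫ r in a..σ, w r) I) :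
    AEMeasurable (circulationInv I w a)
      (volume.restrict (circulationInterval I w a)) :=
  aemeasurable_restrict_of_monotoneOn measurableSet_Ioo
    ((monotoneOn_circulationInv hmono).mono (Ioo_subset_circulation_image hI hw ha))

theorem map_circulationInv (hI : I.OrdConnected) (hIn : I.Nontrivial) (hw : IntegrableOn w I)
    (ha : a ∈ I) (hmono : StrictMonoOn (fun σ => ∫ r in a..σ, w r) I) :
    (volume.restrict (circulationInterval I w a)).map (circulationInv I w a) =
      circulationMeasure I w := by
  have hm := aemeasurable_circulationInv hI hw ha hmono
  rw [← map_circulation hI hIn hw ha hmono] at hm ⊢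
  rw [AEMeasurable.map_map_of_aemeasurable hm (aemeasurable_circulation hI hw ha)]
  conv_rhs => rw [← Measure.map_id (μ := circulationMeasure I w)]
  refine Measure.map_congr ?_
  filter_upwards [circulationMeasure_absolutelyContinuous.ae_le
    (ae_restrict_mem hI.measurableSet)] with σ hσ
  exact circulationInv_circulation hmono hσ

lemma aemeasurable_comp_circulationInv {x : ℝ → Plane} (hI : I.OrdConnected)
    (hIn : I.Nontrivial) (hx : ContinuousOn x I) (hw : IntegrableOn w I) (ha : a ∈ I)
    (hmono : StrictMonoOn (fun σ => ∫ r in a..σ, w r) I) :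
    AEMeasurable (fun g => x (circulationInv I w a g))
      (volume.restrict (circulationInterval I w a)) := by
  have h1 : AEMeasurable x (circulationMeasure I w) :=
    (hx.aemeasurable hI.measurableSet).mono_ac circulationMeasure_absolutelyContinuous
  rw [← map_circulationInv hI hIn hw ha hmono] at h1
  exact h1.comp_aemeasurable (aemeasurable_circulationInv hI hw ha hmono)

/-- In the circulation variable the vorticity has density one. -/
theorem map_comp_circulationInv {x : ℝ → Plane} (hI : I.OrdConnected)
    (hIn : I.Nontrivial) (hx : ContinuousOn x I) (hw : IntegrableOn w I) (ha : a ∈ I)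
    (hmono : StrictMonoOn (fun σ => ∫ r in a..σ, w r) I) :
    (volume.restrict (circulationInterval I w a)).map (fun g => x (circulationInv I w a g)) =
      curveMeasure I x w := by
  have h1 : AEMeasurable x (circulationMeasure I w) :=
    (hx.aemeasurable hI.measurableSet).mono_ac circulationMeasure_absolutelyContinuous
  rw [curveMeasure, ← circulationMeasure]
  rw [← map_circulationInv hI hIn hw ha hmono] at h1 ⊢
  rw [AEMeasurable.map_map_of_aemeasurable h1 (aemeasurable_circulationInv hI hw ha hmono)]
  rfl

/-- The inverse of the circulation is almost everywhere differentiable with positive derivative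
`1 / w`. The exceptional set is controlled because the inverse maps the Lebesgue measure to
`w dσ`. -/
theorem ae_hasDerivAt_circulationInv (hI : I.OrdConnected) (hIn : I.Nontrivial)
    (hw : IntegrableOn w I) (ha : a ∈ I)
    (hmono : StrictMonoOn (fun σ => ∫ r in a..σ, w r) I) {P : ℝ → Prop}
    (hP : ∀ᵐ σ ∂volume.restrict I, P σ) :
    ∀ᵐ g ∂volume.restrict (circulationInterval I w a),
      P (circulationInv I w a g) ∧ 0 < w (circulationInv I w a g) ∧
        HasDerivAt (circulationInv I w a) (w (circulationInv I w a g))⁻¹ g := by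
  have hpos : ∀ᵐ σ ∂circulationMeasure I w, 0 < w σ := by
    rw [circulationMeasure, ae_withDensity_iff' hw.aemeasurable.ennreal_ofReal]
    exact ae_of_all _ fun σ h => by simpa using h
  have hgood : ∀ᵐ σ ∂circulationMeasure I w, P σ ∧ 0 < w σ ∧ σ ∈ interior I ∧
      HasDerivAt (fun s => ∫ r in a..s, w r) (w σ) σ := by
    filter_upwards [circulationMeasure_absolutelyContinuous.ae_le hP, hpos,
      circulationMeasure_absolutelyContinuous.ae_le (ae_mem_interior_of_ordConnected hI),
      circulationMeasure_absolutelyContinuous.ae_le (ae_hasDerivAt_circulation hI hw ha)]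
      with σ h1 h2 h3 h4 using ⟨h1, h2, h3, h4⟩
  rw [← map_circulationInv hI hIn hw ha hmono] at hgood
  have hgood' := ae_of_ae_map (aemeasurable_circulationInv hI hw ha hmono) hgood
  filter_upwards [hgood', ae_restrict_mem measurableSet_Ioo] with g ⟨h1, h2, h3, h4⟩ hg
  refine ⟨h1, h2, ?_⟩
  have hnhds : (fun σ => ∫ r in a..σ, w r) '' I ∈ 𝓝 g :=
    Filter.mem_of_superset (isOpen_Ioo.mem_nhds hg) (Ioo_subset_circulation_image hI hw ha)
  refine HasDerivAt.of_local_left_inverse ?_ h4 h2.ne' ?_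
  · refine continuousAt_of_monotoneOn_of_image_mem_nhds (monotoneOn_circulationInv hmono) hnhds ?_
    refine Filter.mem_of_superset (mem_interior_iff_mem_nhds.1 h3) fun σ hσ => ?_
    exact ⟨_, mem_image_of_mem _ hσ, circulationInv_circulation hmono hσ⟩
  · filter_upwards [hnhds] with g' hg' using circulation_circulationInv hg'

end

/-! ### Conservation of circulation -/

lemma curveMeasure_neg_eq_zero {I : Set ℝ} {x : ℝ → Plane} {w : ℝ → ℝ}
    (hnn : ∀ᵐ σ ∂volume.restrict I, 0 ≤ w σ) : curveMeasure I x (fun σ => -w σ) = 0 := by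
  have h1 : (fun σ => ENNReal.ofReal (-w σ)) =ᵐ[volume.restrict I] 0 := by
    filter_upwards [hnn] with σ hσ
    simpa using hσ
  rw [curveMeasure, withDensity_congr_ae h1, withDensity_zero, Measure.map_zero]

lemma IsVortexSheet.eq_toSignedMeasure {q : ℝ → SignedMeasure Plane} {I : ℝ → Set ℝ}
    {x : ℝ → ℝ → Plane} {γ : ℝ → ℝ → ℝ} (h : IsVortexSheet q I x γ) {t : ℝ}
    (hnn : ∀ᵐ σ ∂volume.restrict (I t), 0 ≤ γ σ t * arcSpeed x σ t)
    [IsFiniteMeasure (curveMeasure (I t) (fun σ => x σ t) fun σ => γ σ t * arcSpeed x σ t)] :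
    q t = (curveMeasure (I t) (fun σ => x σ t)
      fun σ => γ σ t * arcSpeed x σ t).toSignedMeasure := by
  have := isFiniteMeasure_curveMeasure (x := fun σ => x σ t) (h.integrable t).neg
  have h1 := eq_toSignedMeasure_curveMeasure_sub (h.measurableSet t) (h.continuousOn t)
    (h.integrable t) (h.density t)
  rw [h1, Measure.toSignedMeasure_congr (curveMeasure_neg_eq_zero hnn),
    Measure.toSignedMeasure_zero, sub_zero]

lemma IsLagrangianLabelling.image_Ioo {η : ℝ → Plane ≃ₜ Plane} {I : ℝ → Set ℝ}
    {x : ℝ → ℝ → Plane} {ℓ : ℝ → ℝ → ℝ} (h : IsLagrangianLabelling η I x ℓ)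
    (hI : ∀ t, (I t).OrdConnected) (t : ℝ) {a b : ℝ} (ha : a ∈ I 0) (hb : b ∈ I 0) :
    ℓ t '' Ioo a b = Ioo (ℓ t a) (ℓ t b) := by
  have hm := h.strictMonoOn t
  have hsub : Ioo a b ⊆ I 0 := Ioo_subset_Icc_self.trans ((hI 0).out ha hb)
  refine Subset.antisymm ?_ fun p hp => ?_
  · rintro _ ⟨c, hc, rfl⟩
    exact ⟨hm ha (hsub hc) hc.1, hm (hsub hc) hb hc.2⟩
  · have hmem : ∀ c ∈ I 0, ℓ t c ∈ I t := fun c hc => h.image_eq t ▸ mem_image_of_mem _ hc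
    have hpI : p ∈ I t := (hI t).out (hmem a ha) (hmem b hb) (Ioo_subset_Icc_self hp)
    rw [← h.image_eq t] at hpI
    obtain ⟨c, hc, rfl⟩ := hpI
    exact ⟨c, ⟨(hm.lt_iff_lt ha hc).1 hp.1, (hm.lt_iff_lt hc hb).1 hp.2⟩, rfl⟩

/-- Kelvin's theorem for the sheet: the circulation between two particles does not depend on
time. -/
theorem circulation_conserved {α : ℝ} (hα : 0 < α) {qin : SignedMeasure Plane}
    {η : ℝ → Plane ≃ₜ Plane} {u : ℝ → C(Plane, Plane)} {q : ℝ → SignedMeasure Plane}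
    (hsol : IsEulerAlphaSolution α qin η u q) {I : ℝ → Set ℝ} {x : ℝ → ℝ → Plane}
    {γ : ℝ → ℝ → ℝ} (hsheet : IsVortexSheet q I x γ) {ℓ : ℝ → ℝ → ℝ}
    (hℓ : IsLagrangianLabelling η I x ℓ)
    (hnn : ∀ t, ∀ᵐ σ ∂volume.restrict (I t), 0 ≤ γ σ t * arcSpeed x σ t)
    (hinj : ∀ t, InjOn (fun σ => x σ t) (interior (I t))) {a b : ℝ} (ha : a ∈ I 0) (hb : b ∈ I 0)
    (t s : ℝ) : circulation x γ (ℓ t a) (ℓ t b) t = circulation x γ (ℓ s a) (ℓ s b) s := by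
  wlog hab : a ≤ b generalizing a b
  · have := this hb ha (le_of_not_ge hab)
    rw [circulation, circulation, intervalIntegral.integral_symm,
      intervalIntegral.integral_symm (ℓ s b)]
    exact congrArg Neg.neg this
  have := fun t => isFiniteMeasure_curveMeasure (x := fun σ => x σ t) (hsheet.integrable t)
  set μ : ℝ → Measure Plane := fun t =>
    curveMeasure (I t) (fun σ => x σ t) fun σ => γ σ t * arcSpeed x σ t
  have hμ : ∀ t, q t = (μ t).toSignedMeasure := fun t => hsheet.eq_toSignedMeasure (hnn t)
  have hmem : ∀ t, ∀ c ∈ I 0, ℓ t c ∈ I t := fun t c hc => hℓ.image_eq t ▸ mem_image_of_mem _ hc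
  have key : ∀ t, circulation x γ (ℓ t a) (ℓ t b) t
      = (μ 0).real ((fun σ => x σ 0) '' Ioo a b) := by
    intro t
    have h1 := curveMeasure_image_Ioo (hsheet.interval t) (hsheet.continuousOn t)
      (hsheet.integrable t) (hnn t) (hinj t) (hmem t a ha) (hmem t b hb)
      ((hℓ.strictMonoOn t).monotoneOn ha hb hab)
    rw [circulation, ← h1, ← hℓ.image_Ioo hsheet.interval t ha hb, image_image]
    have hsub : Ioo a b ⊆ I 0 := Ioo_subset_Icc_self.trans ((hsheet.interval 0).out ha hb)
    have hint : Ioo a b ⊆ interior (I 0) := interior_maximal hsub isOpen_Ioo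
    have hmeas : MeasurableSet ((fun σ => x σ 0) '' Ioo a b) :=
      measurableSet_Ioo.image_of_continuousOn_injOn ((hsheet.continuousOn 0).mono hsub)
        ((hinj 0).mono hint)
    have h2 : (fun c => x (ℓ t c) t) '' Ioo a b
        = (η t).symm ⁻¹' ((fun σ => x σ 0) '' Ioo a b) := by
      rw [← Homeomorph.image_eq_preimage_symm, image_image]
      exact image_congr fun c hc => hℓ.transported t c (hsub hc)
    rw [h2, measureReal_def, measureReal_def, ← map_flow_symm_eq hα hsol hμ t,
      Measure.map_apply (Homeomorph.measurable _) hmeas]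
  rw [key, key]

/-! ### The Birkhoff-Rott-`α` equation -/

/-- Particles of the sheet move with the velocity induced by the sheet. -/
theorem IsLagrangianLabelling.hasDerivAt_position {α : ℝ} (hα : 0 < α)
    {qin : SignedMeasure Plane} {η : ℝ → Plane ≃ₜ Plane} {u : ℝ → C(Plane, Plane)}
    {q : ℝ → SignedMeasure Plane} (hsol : IsEulerAlphaSolution α qin η u q) {I : ℝ → Set ℝ}
    {x : ℝ → ℝ → Plane} {γ : ℝ → ℝ → ℝ} (hsheet : IsVortexSheet q I x γ) {ℓ : ℝ → ℝ → ℝ}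
    (hℓ : IsLagrangianLabelling η I x ℓ) {a : ℝ} (ha : a ∈ I 0) (t : ℝ) :
    HasDerivAt (fun s => x (ℓ s a) s) (∫ σ' in I t, sheetIntegrand α x γ (ℓ t a) t σ') t := by
  have h1 : (fun s => x (ℓ s a) s) = fun s => η s (x a 0) :=
    funext fun s => hℓ.transported s a ha
  have h2 : ∫ σ' in I t, sheetIntegrand α x γ (ℓ t a) t σ' = u t (x (ℓ t a) t) :=
    (velocity_eq_setIntegral hα hsol hsheet t _).symm
  rw [h1, h2, hℓ.transported t a ha]
  exact hsol.flow_deriv (x a 0) t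

theorem proposition1 (α : ℝ) (hα : 0 < α) (qin : SignedMeasure Plane)
    (η : ℝ → Plane ≃ₜ Plane) (u : ℝ → C(Plane, Plane)) (q : ℝ → SignedMeasure Plane)
    (hsol : IsEulerAlphaSolution α qin η u q)
    (I : ℝ → Set ℝ) (x : ℝ → ℝ → Plane) (γ : ℝ → ℝ → ℝ)
    (hsheet : IsVortexSheet q I x γ) :
    -- the velocity of the fluid particle that sits at `x(σ, t)` at time `t`
    (∀ t, ∀ σ ∈ I t, IntegrableOn (sheetIntegrand α x γ σ t) (I t) ∧
      HasDerivAt (fun s => η s ((η t).symm (x σ t)))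
        (∫ σ' in I t, sheetIntegrand α x γ σ t σ') t) ∧
    ∀ ℓ : ℝ → ℝ → ℝ, IsLagrangianLabelling η I x ℓ →
      -- the evolution equation of the sheet
      (∀ a ∈ I 0, ∀ t, HasDerivAt (fun s => x (ℓ s a) s)
        (∫ σ' in I t, sheetIntegrand α x γ (ℓ t a) t σ') t) ∧
      -- the equation in the circulation variable, measured from the particle `astar`
      ∀ astar ∈ I 0,
        (∀ t, InjOn (fun σ => x σ t) (interior (I t))) →
        (∀ t, StrictMonoOn (fun σ => circulation x γ (ℓ t astar) σ t) (I t)) →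
        ∃ (Γ₀ Γ₁ : ℝ) (X : ℝ → ℝ → Plane), Γ₀ < Γ₁ ∧
          (∀ t, Ioo Γ₀ Γ₁ ⊆ (fun σ => circulation x γ (ℓ t astar) σ t) '' I t ∧
            (fun σ => circulation x γ (ℓ t astar) σ t) '' I t ⊆ Icc Γ₀ Γ₁) ∧
          (∀ t, ∀ σ ∈ I t, X (circulation x γ (ℓ t astar) σ t) t = x σ t) ∧
          (∀ t, ∀ g ∈ (fun σ => circulation x γ (ℓ t astar) σ t) '' I t,
            IntervalIntegrable (fun g' => alphaKernel α (X g t - X g' t)) volume Γ₀ Γ₁ ∧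
            HasDerivAt (fun s => X g s)
              (∫ g' in Γ₀..Γ₁, alphaKernel α (X g t - X g' t)) t) ∧
          (∀ t, ∀ᵐ g ∂volume.restrict (Ioo Γ₀ Γ₁),
            DifferentiableAt ℝ (fun g' => X g' t) g ∧ deriv (fun g' => X g' t) g ≠ 0 ∧
            ∀ σ ∈ I t, circulation x γ (ℓ t astar) σ t = g →
              γ σ t = 1 / ‖deriv (fun g' => X g' t) g‖) := by
  have hvel := velocity_eq_setIntegral hα hsol hsheet
  have hU : ∀ σ t, ∫ σ' in I t, sheetIntegrand α x γ σ t σ' = u t (x σ t) := fun σ t =>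
    (hvel t _).symm
  refine ⟨fun t σ _ => ⟨integrableOn_sheetIntegrand hα hsheet σ t, ?_⟩, fun ℓ hℓ => ⟨?_, ?_⟩⟩
  · rw [hU]
    simpa using hsol.flow_deriv ((η t).symm (x σ t)) t
  · exact fun a ha t => hℓ.hasDerivAt_position hα hsol hsheet ha t
  intro astar hastar hinj hmono
  have hmem : ∀ t, ∀ c ∈ I 0, ℓ t c ∈ I t := fun t c hc => hℓ.image_eq t ▸ mem_image_of_mem _ hc
  have hI := hsheet.interval
  have hIn := hsheet.nontrivial
  have hw := hsheet.integrable
  have hx := hsheet.continuousOn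
  have ha : ∀ t, ℓ t astar ∈ I t := fun t => hmem t astar hastar
  have hnn : ∀ t, ∀ᵐ σ ∂volume.restrict (I t), 0 ≤ γ σ t * arcSpeed x σ t := fun t =>
    ae_nonneg_of_strictMonoOn (hI t) (hw t) (ha t) (hmono t)
  have hcons : ∀ a ∈ I 0, ∀ t s, circulation x γ (ℓ t astar) (ℓ t a) t
      = circulation x γ (ℓ s astar) (ℓ s a) s := fun a h t s =>
    circulation_conserved hα hsol hsheet hℓ hnn hinj hastar h t s
  -- the range of the circulation is parametrized by the particles, hence independent of time
  have hrange : ∀ t, (fun σ => circulation x γ (ℓ t astar) σ t) '' I t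
      = (fun σ => circulation x γ (ℓ 0 astar) σ 0) '' I 0 := fun t => by
    rw [← hℓ.image_eq t, image_image]
    conv_rhs => rw [← hℓ.image_eq 0, image_image]
    exact image_congr fun a h => hcons a h t 0
  let W : ℝ → ℝ → ℝ := fun t σ => γ σ t * arcSpeed x σ t
  let X : ℝ → ℝ → Plane := fun g t => x (circulationInv (I t) (W t) (ℓ t astar) g) t
  have hX : ∀ t, ∀ σ ∈ I t, X (circulation x γ (ℓ t astar) σ t) t = x σ t := fun t σ hσ =>
    congrArg (fun r => x r t) (circulationInv_circulation (hmono t) hσ)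
  refine ⟨sInf ((fun σ => circulation x γ (ℓ 0 astar) σ 0) '' I 0),
    sSup ((fun σ => circulation x γ (ℓ 0 astar) σ 0) '' I 0), X,
    sInf_circulation_lt_sSup (hI 0) (hIn 0) (hw 0) (ha 0) (hmono 0), fun t => ?_, hX,
    fun t g hg => ?_, fun t => ?_⟩
  · rw [hrange t]
    exact ⟨Ioo_subset_circulation_image (hI 0) (hw 0) (ha 0),
      circulation_image_subset_Icc (hI 0) (hw 0) (ha 0)⟩
  · have hle : sInf ((fun σ => circulation x γ (ℓ t astar) σ t) '' I t)
        ≤ sSup ((fun σ => circulation x γ (ℓ t astar) σ t) '' I t) :=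
      (sInf_circulation_lt_sSup (hI t) (hIn t) (hw t) (ha t) (hmono t)).le
    have hmeas := aemeasurable_comp_circulationInv (hI t) (hIn t) (hx t) (hw t) (ha t) (hmono t)
    have hmap := map_comp_circulationInv (hI t) (hIn t) (hx t) (hw t) (ha t) (hmono t)
    obtain ⟨C, -, hC⟩ := exists_norm_alphaKernel_le hα
    have hK : Continuous fun z => alphaKernel α (X g t - z) :=
      (continuous_alphaKernel hα).comp (continuous_const.sub continuous_id)
    rw [← hrange t]
    refine ⟨?_, ?_⟩
    · rw [intervalIntegrable_iff_integrableOn_Ioo_of_le hle]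
      exact Integrable.of_bound (hK.measurable.comp_aemeasurable hmeas).aestronglyMeasurable C
        (ae_of_all _ fun g' => hC _)
    · have hint : ∫ g' in sInf ((fun σ => circulation x γ (ℓ t astar) σ t) '' I t)..
          sSup ((fun σ => circulation x γ (ℓ t astar) σ t) '' I t),
          alphaKernel α (X g t - X g' t) = u t (X g t) := by
        rw [intervalIntegral.integral_of_le hle, integral_Ioc_eq_integral_Ioo]
        have h1 := integral_map (f := fun z => alphaKernel α (X g t - z)) hmeas
          hK.aestronglyMeasurable
        rw [hmap, integral_curveMeasure (hI t).measurableSet (hx t) (hw t)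
          hK.stronglyMeasurable] at h1
        refine h1.symm.trans ?_
        rw [hvel]
        refine integral_congr_ae ?_
        filter_upwards [hnn t] with σ hσ
        rw [max_eq_left hσ]
      rw [hint]
      obtain ⟨σ, hσ, rfl⟩ := hg
      rw [← hℓ.image_eq t] at hσ
      obtain ⟨a, haI, rfl⟩ := hσ
      have hXs : (fun s => X (circulation x γ (ℓ t astar) (ℓ t a) t) s)
          = fun s => x (ℓ s a) s := by
        ext1 s
        rw [hcons a haI t s, hX s _ (hmem s a haI)]
      have hXt := congrFun hXs t
      simp only at hXt ⊢
      rw [hXs, hXt, ← hU]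
      exact hℓ.hasDerivAt_position hα hsol hsheet haI t
  · rw [← hrange t]
    have hgood := ae_hasDerivAt_circulationInv (hI t) (hIn t) (hw t) (ha t) (hmono t)
      (hsheet.differentiable t)
    refine hgood.mono fun g hg => ?_
    obtain ⟨h1, h2, h3⟩ := hg
    set σ := circulationInv (I t) (W t) (ℓ t astar) g with hσ
    have hd : HasDerivAt (fun g' => X g' t)
        ((γ σ t * arcSpeed x σ t)⁻¹ • deriv (fun s => x s t) σ) g :=
      HasDerivAt.scomp (g₁ := fun s => x s t) g h1.hasDerivAt h3
    have hne : arcSpeed x σ t ≠ 0 := right_ne_zero_of_mul h2.ne'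
    rw [hd.deriv]
    refine ⟨hd.differentiableAt, smul_ne_zero (inv_ne_zero h2.ne') (norm_ne_zero_iff.1 hne),
      fun σ' hσ' hg' => ?_⟩
    have : σ' = σ := by
      rw [hσ, ← hg']
      exact (circulationInv_circulation (hmono t) hσ').symm
    rw [this, norm_smul, norm_inv, Real.norm_of_nonneg h2.le, ← arcSpeed]
    field_simp
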